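/- **Setting.** The language has free and bound variables, function symbols $f^n_i$ and predicate symbols $P^n_i$ of every arity $n\ge 0$ ($i\in\mathbb N$), identity $=$, the constants $\bot,\top$, the connectives $\lnot,\land,\lor,\to,\leftrightarrow$, and $\varepsilon$; $\varepsilon x\,A(x)$ is a term whenever $A(x)$ is a formula in which $x$ occurs free. Expressions are identified up to renaming of bound variables. A term $t$ is a subterm of $s$ if $s$ is $s'[x/t]$ for some term $s'$ in which $x$ occurs free; it is a proper subterm if moreover $t\neq s$, and an immediate subterm if it is a proper subterm of $s$ but not a proper subterm of a proper subterm of $s$. *Rank of terms.* An $\varepsilon$-term occurring in $\varepsilon x\,A(x)$ is subordinate to it if it contains this bound variable $x$. The rank $\mathrm{rk}(e)$ of an $\varepsilon$-term $e$ is $1$ if no $\varepsilon$-term is subordinate to $e$, and otherwise $1$ plus the maximal rank of the $\varepsilon$-terms subordinate to $e$. *Types.* An $\varepsilon$-type is an $\varepsilon$-term $p=\varepsilon x\,A(x;x_1,\dots,x_n)$ whose immediate subterms are exactly its free variables $x_1,\dots,x_n$, each of which occurs exactly once. *Axioms and proofs.* The axioms are all propositional tautologies, all $t=t$ $(=_1)$,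 and all instances of $$t=u\to\bigl(P(s_1,\dots,t,\dots,s_n)\to P(s_1,\dots,u,\dots,s_n)\bigr)\quad(='_2)$$ for every predicate symbol $P$, including $=$, $$t=u\to f^n_i(s_1,\dots,t,\dots,s_n)=f^n_i(s_1,\dots,u,\dots,s_n)\quad(=''_2),$$ $$t=u\to \varepsilon x\,A(x;s_1,\dots,t,\dots,s_n)=\varepsilon x\,A(x;s_1,\dots,u,\dots,s_n)\quad(=_\varepsilon),$$ where $\varepsilon x\,A(x;x_1,\dots,x_n)$ is an $\varepsilon$-type and, in each schema, $t$ and $u$ stand in the same argument position, and the critical formulas $A(t)\to A(\varepsilon x\,A(x))$. A proof of $E$ is a finite sequence of formulas ending in $E$, each of which is an axiom or follows from two earlier ones by modus ponens. An $\varepsilon$-term $\varepsilon x\,A(x)$ is critical in a proof $\pi$ if some critical formula $A(t)\to A(\varepsilon x\,A(x))$ occurs in $\pi$. The rank $\mathrm{rk}(\pi)$ is the maximal rank of the $\varepsilon$-terms critical in $\pi$ ($0$ if there are none). An $\varepsilon$-term $e$ is special in $\pi$ if an instance $t=u\to e'=e$ of $(=_\varepsilon)$ occurs in $\pi$. **Theorem.**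 Let $\pi$ be a proof of a formula $E$ that does not contain $\varepsilon$. Then there is a proof $\pi^{=}$ of $E$ such that $\mathrm{rk}(\pi^{=})=\mathrm{rk}(\pi)$ and every $\varepsilon$-term that is special in $\pi^{=}$ has rank $<\mathrm{rk}(\pi)$. -/

import Mathlib

namespace EpsCalc

/-! Syntax of the language with identity and `ε` (no quantifiers), in locally nameless form.
Free variables `x_0, x_1, …` are `fvar 0, fvar 1, …`. A bound variable is `bvar d`, where `d` is
the number of `ε`-binders between the occurrence and its own binder. Hence expressions that differ
only by a renaming of bound variables are equal. -/

mutual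

/-- Raw terms. -/
inductive Tm : Type where
  | fvar (x : ℕ) : Tm
  | bvar (d : ℕ) : Tm
  /-- `f^n_i(t_1, …, t_n)`; constants are the case `n = 0`. -/
  | fn (n i : ℕ) (ts : Fin n → Tm) : Tm
  /-- `ε x A(x)`; in `A` the variable `x` is the bound variable of index `0`. -/
  | eps (A : Fm) : Tm

/-- Raw formulas. -/
inductive Fm : Type where
  /-- `P^n_i(t_1, …, t_n)`. -/
  | pred (n i : ℕ) (ts : Fin n → Tm) : Fm
  | eq (t u : Tm) : Fm
  | bot : Fm
  | top : Fm
  | neg (A : Fm) : Fm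
  | and (A B : Fm) : Fm
  | or (A B : Fm) : Fm
  | imp (A B : Fm) : Fm
  | iff (A B : Fm) : Fm

end

mutual

/-- Number of occurrences of the free variable `x`. -/
def Tm.count (x : ℕ) : Tm → ℕ
  | .fvar y => if y = x then 1 else 0
  | .bvar _ => 0
  | .fn _ _ ts => ∑ j, Tm.count x (ts j)
  | .eps A => Fm.count x A

/-- Number of occurrences of the free variable `x`. -/
def Fm.count (x : ℕ) : Fm → ℕ
  | .pred _ _ ts => ∑ j, Tm.count x (ts j)
  | .eq t u => Tm.count x t + Tm.count x u
  | .bot => 0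
  | .top => 0
  | .neg A => Fm.count x A
  | .and A B => Fm.count x A + Fm.count x B
  | .or A B => Fm.count x A + Fm.count x B
  | .imp A B => Fm.count x A + Fm.count x B
  | .iff A B => Fm.count x A + Fm.count x B

end

mutual

/-- Number of occurrences of the bound variable which has index `d` at the root of the
expression. -/
def Tm.bcount : Tm → ℕ → ℕ
  | .fvar _, _ => 0
  | .bvar c, d => if c = d then 1 else 0
  | .fn _ _ ts, d => ∑ j, Tm.bcount (ts j) d
  | .eps A, d => Fm.bcount A (d + 1)

/-- Number of occurrences of the bound variable which has index `d` at the root of the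
expression. -/
def Fm.bcount : Fm → ℕ → ℕ
  | .pred _ _ ts, d => ∑ j, Tm.bcount (ts j) d
  | .eq t u, d => Tm.bcount t d + Tm.bcount u d
  | .bot, _ => 0
  | .top, _ => 0
  | .neg A, d => Fm.bcount A d
  | .and A B, d => Fm.bcount A d + Fm.bcount B d
  | .or A B, d => Fm.bcount A d + Fm.bcount B d
  | .imp A B, d => Fm.bcount A d + Fm.bcount B d
  | .iff A B, d => Fm.bcount A d + Fm.bcount B d

end

mutual

/-- Well-formedness in the scope of `d` binders: bound variables have a binder, and `ε x A` is
formed only if `x` occurs in `A`. -/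
def Tm.WFAt : Tm → ℕ → Prop
  | .fvar _, _ => True
  | .bvar c, d => c < d
  | .fn _ _ ts, d => ∀ j, Tm.WFAt (ts j) d
  | .eps A, d => Fm.WFAt A (d + 1) ∧ 0 < Fm.bcount A 0

/-- Well-formedness in the scope of `d` binders. -/
def Fm.WFAt : Fm → ℕ → Prop
  | .pred _ _ ts, d => ∀ j, Tm.WFAt (ts j) d
  | .eq t u, d => Tm.WFAt t d ∧ Tm.WFAt u d
  | .bot, _ => True
  | .top, _ => True
  | .neg A, d => Fm.WFAt A d
  | .and A B, d => Fm.WFAt A d ∧ Fm.WFAt B d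
  | .or A B, d => Fm.WFAt A d ∧ Fm.WFAt B d
  | .imp A B, d => Fm.WFAt A d ∧ Fm.WFAt B d
  | .iff A B, d => Fm.WFAt A d ∧ Fm.WFAt B d

end

/-- `t` is a term of the language. -/
def Tm.WF (t : Tm) : Prop := t.WFAt 0

/-- `A` is a formula of the language. -/
def Fm.WF (A : Fm) : Prop := A.WFAt 0

mutual

/-- `t` contains no `ε`. -/
def Tm.EpsFree : Tm → Prop
  | .fvar _ => True
  | .bvar _ => True
  | .fn _ _ ts => ∀ j, Tm.EpsFree (ts j)
  | .eps _ => False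

/-- `A` contains no `ε`. -/
def Fm.EpsFree : Fm → Prop
  | .pred _ _ ts => ∀ j, Tm.EpsFree (ts j)
  | .eq t u => Tm.EpsFree t ∧ Tm.EpsFree u
  | .bot => True
  | .top => True
  | .neg A => Fm.EpsFree A
  | .and A B => Fm.EpsFree A ∧ Fm.EpsFree B
  | .or A B => Fm.EpsFree A ∧ Fm.EpsFree B
  | .imp A B => Fm.EpsFree A ∧ Fm.EpsFree B
  | .iff A B => Fm.EpsFree A ∧ Fm.EpsFree B

end

mutual

/-- Simultaneous substitution of `σ x` for every free variable `x`. It is used only with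
well-formed `σ x`, which have no unbound `bvar`, so nothing is captured. -/
def Tm.subst (σ : ℕ → Tm) : Tm → Tm
  | .fvar x => σ x
  | .bvar d => .bvar d
  | .fn n i ts => .fn n i fun j => Tm.subst σ (ts j)
  | .eps A => .eps (Fm.subst σ A)

/-- Simultaneous substitution of `σ x` for every free variable `x`. -/
def Fm.subst (σ : ℕ → Tm) : Fm → Fm
  | .pred n i ts => .pred n i fun j => Tm.subst σ (ts j)
  | .eq t u => .eq (Tm.subst σ t) (Tm.subst σ u)
  | .bot => .bot
  | .top => .top
  | .neg A => .neg (Fm.subst σ A)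
  | .and A B => .and (Fm.subst σ A) (Fm.subst σ B)
  | .or A B => .or (Fm.subst σ A) (Fm.subst σ B)
  | .imp A B => .imp (Fm.subst σ A) (Fm.subst σ B)
  | .iff A B => .iff (Fm.subst σ A) (Fm.subst σ B)

end

mutual

/-- Replace the bound variable of index `d` by `s`. It is used only with well-formed `s`. -/
def Tm.inst (s : Tm) : Tm → ℕ → Tm
  | .fvar x, _ => .fvar x
  | .bvar c, d => if c = d then s else .bvar c
  | .fn n i ts, d => .fn n i fun j => Tm.inst s (ts j) d
  | .eps A, d => .eps (Fm.inst s A (d + 1))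

/-- Replace the bound variable of index `d` by `s`. If `ε x A(x)` is `eps A`, then `A(s)` is
`Fm.inst s A 0`. -/
def Fm.inst (s : Tm) : Fm → ℕ → Fm
  | .pred n i ts, d => .pred n i fun j => Tm.inst s (ts j) d
  | .eq t u, d => .eq (Tm.inst s t d) (Tm.inst s u d)
  | .bot, _ => .bot
  | .top, _ => .top
  | .neg A, d => .neg (Fm.inst s A d)
  | .and A B, d => .and (Fm.inst s A d) (Fm.inst s B d)
  | .or A B, d => .or (Fm.inst s A d) (Fm.inst s B d)
  | .imp A B, d => .imp (Fm.inst s A d) (Fm.inst s B d)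
  | .iff A B, d => .iff (Fm.inst s A d) (Fm.inst s B d)

end

/-- `A(s)`, where `A` is the body of `ε x A(x)`. -/
def Fm.app (A : Fm) (s : Tm) : Fm := Fm.inst s A 0

/-! ### Rank

An `ε`-term occurring in `ε x A(x)` is subordinate to it if it contains `x`. The rank of an
`ε`-term is `1 + ` the maximal rank of its subordinate `ε`-terms (`1` if there are none). -/

mutual

/-- The maximal rank of the `ε`-terms that occur in the expression and contain the bound variable
which has index `d` at the root of the expression (`0` if there are none). -/
def Tm.subRank : Tm → ℕ → ℕ
  | .fvar _, _ => 0
  | .bvar _, _ => 0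
  | .fn _ _ ts, d => Finset.univ.sup fun j => Tm.subRank (ts j) d
  | .eps A, d => max (if 0 < Fm.bcount A (d + 1) then 1 + Fm.subRank A 0 else 0)
      (Fm.subRank A (d + 1))

/-- The maximal rank of the `ε`-terms that occur in the expression and contain the bound variable
which has index `d` at the root of the expression (`0` if there are none). -/
def Fm.subRank : Fm → ℕ → ℕ
  | .pred _ _ ts, d => Finset.univ.sup fun j => Tm.subRank (ts j) d
  | .eq t u, d => max (Tm.subRank t d) (Tm.subRank u d)
  | .bot, _ => 0
  | .top, _ => 0
  | .neg A, d => Fm.subRank A d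
  | .and A B, d => max (Fm.subRank A d) (Fm.subRank B d)
  | .or A B, d => max (Fm.subRank A d) (Fm.subRank B d)
  | .imp A B, d => max (Fm.subRank A d) (Fm.subRank B d)
  | .iff A B, d => max (Fm.subRank A d) (Fm.subRank B d)

end

/-- The rank of an `ε`-term (`0` for other terms). -/
def Tm.rank : Tm → ℕ
  | .eps A => 1 + A.subRank 0
  | _ => 0

/-! ### Subterms and `ε`-types -/

/-- `t` is a subterm of `s`: `s` is `s'[x/t]` for some `s'` in which `x` occurs. -/
def Subterm (t s : Tm) : Prop :=
  t.WF ∧ ∃ (s' : Tm) (x : ℕ), s'.WF ∧ 0 < s'.count x ∧ s = s'.subst (Function.update Tm.fvar x t)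

/-- `t` is a proper subterm of `s`. -/
def ProperSubterm (t s : Tm) : Prop := Subterm t s ∧ t ≠ s

/-- `t` is an immediate subterm of `s`: a proper subterm of `s` that is not a proper subterm of a
proper subterm of `s`. -/
def ImmediateSubterm (t s : Tm) : Prop :=
  ProperSubterm t s ∧ ¬ ∃ u, ProperSubterm u s ∧ ProperSubterm t u

/-- `p` is an `ε`-type: an `ε`-term whose immediate subterms are exactly its free variables, each
of which occurs only once. -/
def IsEpsType (p : Tm) : Prop :=
  p.WF ∧ (∃ A, p = .eps A) ∧
    (∀ t, ImmediateSubterm t p ↔ ∃ x, 0 < p.count x ∧ t = .fvar x) ∧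
    ∀ x, p.count x ≤ 1

/-! ### Axioms and proofs -/

/-- Truth value of a formula under a truth assignment `v` to the atomic formulas. -/
def Fm.val (v : Fm → Prop) : Fm → Prop
  | .pred n i ts => v (.pred n i ts)
  | .eq t u => v (.eq t u)
  | .bot => False
  | .top => True
  | .neg A => ¬ Fm.val v A
  | .and A B => Fm.val v A ∧ Fm.val v B
  | .or A B => Fm.val v A ∨ Fm.val v B
  | .imp A B => Fm.val v A → Fm.val v B
  | .iff A B => (Fm.val v A ↔ Fm.val v B)

/-- `F` is a (substitution instance of a) propositional tautology. -/
def IsTaut (F : Fm) : Prop := ∀ v, F.val v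

/-- `F` is a critical formula `A(t) → A(ε x A(x))` belonging to `e = ε x A(x)`. -/
def IsCrit (F : Fm) (e : Tm) : Prop :=
  ∃ (A : Fm) (t : Tm), e = .eps A ∧ e.WF ∧ t.WF ∧ F = .imp (A.app t) (A.app e)

/-- `F` is an instance `t = u → e' = e` of the `ε`-identity schema, i.e. `e'` and `e` are
`ε x A(x; s_1, …, t, …, s_n)` and `ε x A(x; s_1, …, u, …, s_n)` for an `ε`-type
`ε x A(x; x_1, …, x_n)`. -/
def IsEpsId (F : Fm) (e' e : Tm) : Prop :=
  ∃ (p : Tm) (σ : ℕ → Tm) (x : ℕ) (t u : Tm),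
    IsEpsType p ∧ 0 < p.count x ∧ (∀ y, (σ y).WF) ∧ t.WF ∧ u.WF ∧
    e' = p.subst (Function.update σ x t) ∧ e = p.subst (Function.update σ x u) ∧
    F = .imp (.eq t u) (.eq e' e)

/-- The axioms of the `ε`-calculus with identity in which the replacement schema
`t = u → (A(t) ↔ A(u))` is replaced by its restrictions to predicate symbols (including `=`) and to
function symbols, and by the `ε`-identity schema. -/
inductive IsAxiom : Fm → Prop where
  | taut (F : Fm) : IsTaut F → IsAxiom F
  | refl (t : Tm) : IsAxiom (.eq t t)
  | predId (n i : ℕ) (s : Fin n → Tm) (j : Fin n) (t u : Tm) :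
      IsAxiom (.imp (.eq t u)
        (.imp (.pred n i (Function.update s j t)) (.pred n i (Function.update s j u))))
  | eqIdLeft (t u s : Tm) : IsAxiom (.imp (.eq t u) (.imp (.eq t s) (.eq u s)))
  | eqIdRight (t u s : Tm) : IsAxiom (.imp (.eq t u) (.imp (.eq s t) (.eq s u)))
  | fnId (n i : ℕ) (s : Fin n → Tm) (j : Fin n) (t u : Tm) :
      IsAxiom (.imp (.eq t u)
        (.eq (.fn n i (Function.update s j t)) (.fn n i (Function.update s j u))))
  | epsId (F : Fm) (e' e : Tm) : IsEpsId F e' e → IsAxiom F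
  | crit (F : Fm) (e : Tm) : IsCrit F e → IsAxiom F

/-- `π` is a proof of `E`: a finite sequence of formulas ending in `E`, each of which is an axiom or
follows from two earlier ones by modus ponens. -/
def IsProof (π : List Fm) (E : Fm) : Prop :=
  π.getLast? = some E ∧
  (∀ F ∈ π, F.WF) ∧
  ∀ i (hi : i < π.length), IsAxiom π[i] ∨
    ∃ k l, ∃ (hk : k < i) (hl : l < i), π[l] = .imp π[k] π[i]

/-- The `ε`-term `e` is critical in `π`. -/
def CriticalIn (e : Tm) (π : List Fm) : Prop := ∃ F ∈ π, IsCrit F e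

/-- The `ε`-term `e` is special in `π`: some `t = u → e' = e` in `π` is an instance of the
`ε`-identity schema. -/
def SpecialIn (e : Tm) (π : List Fm) : Prop := ∃ F ∈ π, ∃ e', IsEpsId F e' e

/-- The rank of `π`: the maximal rank of its critical `ε`-terms, `0` if there are none. -/
noncomputable def proofRank (π : List Fm) : ℕ := sSup {r | ∃ e, CriticalIn e π ∧ e.rank = r}

/-! ### The maximum in the definition of `proofRank` exists -/

mutual

/-- Number of symbols. -/
def Tm.size : Tm → ℕ
  | .fvar _ => 1
  | .bvar _ => 1
  | .fn _ _ ts => 1 + ∑ j, Tm.size (ts j)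
  | .eps A => 1 + Fm.size A

/-- Number of symbols. -/
def Fm.size : Fm → ℕ
  | .pred _ _ ts => 1 + ∑ j, Tm.size (ts j)
  | .eq t u => 1 + Tm.size t + Tm.size u
  | .bot => 1
  | .top => 1
  | .neg A => 1 + Fm.size A
  | .and A B => 1 + Fm.size A + Fm.size B
  | .or A B => 1 + Fm.size A + Fm.size B
  | .imp A B => 1 + Fm.size A + Fm.size B
  | .iff A B => 1 + Fm.size A + Fm.size B

end

mutual

theorem Tm.subRank_le_size : ∀ (t : Tm) (d : ℕ), t.subRank d ≤ t.size
  | .fvar _, _ => by simp [Tm.subRank]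
  | .bvar _, _ => by simp [Tm.subRank]
  | .fn n i ts, d => by
      simp only [Tm.subRank, Tm.size]
      refine Finset.sup_le fun j _ => (Tm.subRank_le_size (ts j) d).trans ?_
      have := Finset.single_le_sum (f := fun j => Tm.size (ts j)) (fun _ _ => Nat.zero_le _)
        (Finset.mem_univ j)
      omega
  | .eps A, d => by
      have h1 := Fm.subRank_le_size A 0
      have h2 := Fm.subRank_le_size A (d + 1)
      simp only [Tm.subRank, Tm.size]
      split_ifs <;> omega

theorem Fm.subRank_le_size : ∀ (A : Fm) (d : ℕ), A.subRank d ≤ A.size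
  | .pred n i ts, d => by
      simp only [Fm.subRank, Fm.size]
      refine Finset.sup_le fun j _ => (Tm.subRank_le_size (ts j) d).trans ?_
      have := Finset.single_le_sum (f := fun j => Tm.size (ts j)) (fun _ _ => Nat.zero_le _)
        (Finset.mem_univ j)
      omega
  | .eq t u, d => by
      have h1 := Tm.subRank_le_size t d
      have h2 := Tm.subRank_le_size u d
      simp only [Fm.subRank, Fm.size]
      omega
  | .bot, _ => by simp [Fm.subRank]
  | .top, _ => by simp [Fm.subRank]
  | .neg A, d => by
      have h1 := Fm.subRank_le_size A d
      simp only [Fm.subRank, Fm.size]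
      omega
  | .and A B, d | .or A B, d | .imp A B, d | .iff A B, d => by
      have h1 := Fm.subRank_le_size A d
      have h2 := Fm.subRank_le_size B d
      simp only [Fm.subRank, Fm.size]
      omega

end

mutual

theorem Tm.size_le_inst (s : Tm) :
    ∀ (t : Tm) (d : ℕ), 0 < t.bcount d → s.size ≤ (Tm.inst s t d).size
  | .fvar _, _, h => by simp [Tm.bcount] at h
  | .bvar c, d, h => by
      have hc : c = d := by
        by_contra hc
        simp [Tm.bcount, hc] at h
      simp [Tm.inst, hc]
  | .fn n i ts, d, h => by
      simp only [Tm.bcount] at h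
      obtain ⟨j, _, hj⟩ := Finset.exists_ne_zero_of_sum_ne_zero h.ne'
      have h1 := Tm.size_le_inst s (ts j) d (Nat.pos_of_ne_zero hj)
      have := Finset.single_le_sum (f := fun j => (Tm.inst s (ts j) d).size)
        (fun _ _ => Nat.zero_le _) (Finset.mem_univ j)
      simp only [Tm.inst, Tm.size] at this ⊢
      omega
  | .eps A, d, h => by
      have h1 := Fm.size_le_inst s A (d + 1) h
      simp only [Tm.inst, Tm.size]
      omega

theorem Fm.size_le_inst (s : Tm) :
    ∀ (A : Fm) (d : ℕ), 0 < A.bcount d → s.size ≤ (Fm.inst s A d).size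
  | .pred n i ts, d, h => by
      simp only [Fm.bcount] at h
      obtain ⟨j, _, hj⟩ := Finset.exists_ne_zero_of_sum_ne_zero h.ne'
      have h1 := Tm.size_le_inst s (ts j) d (Nat.pos_of_ne_zero hj)
      have := Finset.single_le_sum (f := fun j => (Tm.inst s (ts j) d).size)
        (fun _ _ => Nat.zero_le _) (Finset.mem_univ j)
      simp only [Fm.inst, Fm.size] at this ⊢
      omega
  | .eq t u, d, h => by
      simp only [Fm.bcount, Nat.add_pos_iff_pos_or_pos] at h
      simp only [Fm.inst, Fm.size]
      rcases h with h | h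
      · have := Tm.size_le_inst s t d h
        omega
      · have := Tm.size_le_inst s u d h
        omega
  | .bot, _, h => by simp [Fm.bcount] at h
  | .top, _, h => by simp [Fm.bcount] at h
  | .neg A, d, h => by
      have h1 := Fm.size_le_inst s A d h
      simp only [Fm.inst, Fm.size]
      omega
  | .and A B, d, h | .or A B, d, h | .imp A B, d, h | .iff A B, d, h => by
      simp only [Fm.bcount, Nat.add_pos_iff_pos_or_pos] at h
      simp only [Fm.inst, Fm.size]
      rcases h with h | h
      · have := Fm.size_le_inst s A d h
        omega
      · have := Fm.size_le_inst s B d h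
        omega

end

theorem bddAbove_critical_ranks (π : List Fm) :
    BddAbove {r | ∃ e, CriticalIn e π ∧ e.rank = r} := by
  refine ⟨(π.map Fm.size).sum, ?_⟩
  rintro r ⟨e, ⟨F, hF, A, t, he, hwf, -, rfl⟩, rfl⟩
  have h1 : e.rank ≤ e.size := by
    subst he
    have := Fm.subRank_le_size A 0
    simp only [Tm.rank, Tm.size]
    omega
  have h2 : e.size ≤ (A.app e).size := by
    have hw : 0 < A.bcount 0 := by
      rw [he] at hwf
      exact hwf.2
    exact Fm.size_le_inst e A 0 hw
  have h3 := List.single_le_sum (fun _ _ => Nat.zero_le _) _ (List.mem_map_of_mem (f := Fm.size) hF)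
  simp only [Fm.size] at h3
  omega

end EpsCalc

namespace EpsCalc

/-! ### Bound variables, substitution and instantiation -/

mutual

theorem Tm.WFAt.mono : ∀ {t : Tm} {d d' : ℕ}, t.WFAt d → d ≤ d' → t.WFAt d'
  | .fvar _, _, _, _, _ => by simp [Tm.WFAt]
  | .bvar c, d, d', h, hd => by simp only [Tm.WFAt] at h ⊢; omega
  | .fn n i ts, d, d', h, hd => by
      simp only [Tm.WFAt] at h ⊢
      exact fun j => Tm.WFAt.mono (h j) hd
  | .eps A, d, d', h, hd => by
      simp only [Tm.WFAt] at h ⊢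
      exact ⟨Fm.WFAt.mono h.1 (by omega), h.2⟩

theorem Fm.WFAt.mono : ∀ {A : Fm} {d d' : ℕ}, A.WFAt d → d ≤ d' → A.WFAt d'
  | .pred n i ts, d, d', h, hd => by
      simp only [Fm.WFAt] at h ⊢
      exact fun j => Tm.WFAt.mono (h j) hd
  | .eq t u, d, d', h, hd => by
      simp only [Fm.WFAt] at h ⊢
      exact ⟨Tm.WFAt.mono h.1 hd, Tm.WFAt.mono h.2 hd⟩
  | .bot, _, _, _, _ | .top, _, _, _, _ => by simp [Fm.WFAt]
  | .neg A, d, d', h, hd => by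
      simp only [Fm.WFAt] at h ⊢
      exact Fm.WFAt.mono h hd
  | .and A B, d, d', h, hd | .or A B, d, d', h, hd | .imp A B, d, d', h, hd
  | .iff A B, d, d', h, hd => by
      simp only [Fm.WFAt] at h ⊢
      exact ⟨Fm.WFAt.mono h.1 hd, Fm.WFAt.mono h.2 hd⟩

end

mutual

theorem Tm.WFAt.bcount_eq_zero : ∀ {t : Tm} {d c : ℕ}, t.WFAt d → d ≤ c → t.bcount c = 0
  | .fvar _, _, _, _, _ => by simp [Tm.bcount]
  | .bvar c, d, d', h, hd => by simp only [Tm.WFAt, Tm.bcount] at h ⊢; split_ifs <;> omega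
  | .fn n i ts, d, d', h, hd => by
      simp only [Tm.WFAt] at h
      simp only [Tm.bcount]
      exact Finset.sum_eq_zero fun j _ => Tm.WFAt.bcount_eq_zero (h j) hd
  | .eps A, d, d', h, hd => by
      simp only [Tm.WFAt] at h
      simp only [Tm.bcount]
      exact Fm.WFAt.bcount_eq_zero h.1 (by omega)

theorem Fm.WFAt.bcount_eq_zero : ∀ {A : Fm} {d c : ℕ}, A.WFAt d → d ≤ c → A.bcount c = 0
  | .pred n i ts, d, d', h, hd => by
      simp only [Fm.WFAt] at h
      simp only [Fm.bcount]
      exact Finset.sum_eq_zero fun j _ => Tm.WFAt.bcount_eq_zero (h j) hd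
  | .eq t u, d, d', h, hd => by
      simp only [Fm.WFAt] at h
      simp only [Fm.bcount]
      rw [Tm.WFAt.bcount_eq_zero h.1 hd, Tm.WFAt.bcount_eq_zero h.2 hd]
  | .bot, _, _, _, _ | .top, _, _, _, _ => by simp [Fm.bcount]
  | .neg A, d, d', h, hd => by
      simp only [Fm.WFAt] at h
      simp only [Fm.bcount]
      exact Fm.WFAt.bcount_eq_zero h hd
  | .and A B, d, d', h, hd | .or A B, d, d', h, hd | .imp A B, d, d', h, hd
  | .iff A B, d, d', h, hd => by
      simp only [Fm.WFAt] at h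
      simp only [Fm.bcount]
      rw [Fm.WFAt.bcount_eq_zero h.1 hd, Fm.WFAt.bcount_eq_zero h.2 hd]

end

mutual

theorem Tm.subRank_eq_zero : ∀ {t : Tm} {d : ℕ}, t.bcount d = 0 → t.subRank d = 0
  | .fvar _, _, _ | .bvar _, _, _ => by simp [Tm.subRank]
  | .fn n i ts, d, h => by
      simp only [Tm.bcount, Finset.sum_eq_zero_iff] at h
      simp only [Tm.subRank]
      refine Nat.eq_zero_of_le_zero (Finset.sup_le fun j hj => ?_)
      rw [Tm.subRank_eq_zero (h j hj)]
  | .eps A, d, h => by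
      simp only [Tm.bcount] at h
      simp only [Tm.subRank, Fm.subRank_eq_zero h, h]
      simp

theorem Fm.subRank_eq_zero : ∀ {A : Fm} {d : ℕ}, A.bcount d = 0 → A.subRank d = 0
  | .pred n i ts, d, h => by
      simp only [Fm.bcount, Finset.sum_eq_zero_iff] at h
      simp only [Fm.subRank]
      refine Nat.eq_zero_of_le_zero (Finset.sup_le fun j hj => ?_)
      rw [Tm.subRank_eq_zero (h j hj)]
  | .eq t u, d, h => by
      simp only [Fm.bcount, Nat.add_eq_zero_iff] at h
      simp [Fm.subRank, Tm.subRank_eq_zero h.1, Tm.subRank_eq_zero h.2]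
  | .bot, _, _ | .top, _, _ => by simp [Fm.subRank]
  | .neg A, d, h => by
      simp only [Fm.bcount] at h
      simp [Fm.subRank, Fm.subRank_eq_zero h]
  | .and A B, d, h | .or A B, d, h | .imp A B, d, h | .iff A B, d, h => by
      simp only [Fm.bcount, Nat.add_eq_zero_iff] at h
      simp [Fm.subRank, Fm.subRank_eq_zero h.1, Fm.subRank_eq_zero h.2]

end

theorem Tm.WF.wfAt {t : Tm} (h : t.WF) (d : ℕ) : t.WFAt d := Tm.WFAt.mono h (Nat.zero_le d)

theorem Tm.WF.bcount {t : Tm} (h : t.WF) (d : ℕ) : t.bcount d = 0 :=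
  Tm.WFAt.bcount_eq_zero h (Nat.zero_le d)

theorem Tm.WF.subRank {t : Tm} (h : t.WF) (d : ℕ) : t.subRank d = 0 :=
  Tm.subRank_eq_zero (h.bcount d)

theorem Tm.wf_fvar (x : ℕ) : (Tm.fvar x).WF := by simp [Tm.WF, Tm.WFAt]

theorem Tm.not_wf_bvar (d : ℕ) : ¬ (Tm.bvar d).WF := by simp [Tm.WF, Tm.WFAt]

theorem Tm.wf_fn {n i : ℕ} {ts : Fin n → Tm} : (Tm.fn n i ts).WF ↔ ∀ j, (ts j).WF := by
  simp [Tm.WF, Tm.WFAt]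

mutual

theorem Tm.inst_of_bcount_eq_zero (s : Tm) :
    ∀ {t : Tm} {d : ℕ}, t.bcount d = 0 → Tm.inst s t d = t
  | .fvar _, _, _ => by simp [Tm.inst]
  | .bvar c, d, h => by
      simp only [Tm.bcount] at h
      split_ifs at h with hc
      simp [Tm.inst, hc]
  | .fn n i ts, d, h => by
      simp only [Tm.bcount, Finset.sum_eq_zero_iff] at h
      simp only [Tm.inst]
      congr 1
      funext j
      exact Tm.inst_of_bcount_eq_zero s (h j (Finset.mem_univ j))
  | .eps A, d, h => by
      simp only [Tm.bcount] at h
      simp only [Tm.inst, Fm.inst_of_bcount_eq_zero s h]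

theorem Fm.inst_of_bcount_eq_zero (s : Tm) :
    ∀ {A : Fm} {d : ℕ}, A.bcount d = 0 → Fm.inst s A d = A
  | .pred n i ts, d, h => by
      simp only [Fm.bcount, Finset.sum_eq_zero_iff] at h
      simp only [Fm.inst]
      congr 1
      funext j
      exact Tm.inst_of_bcount_eq_zero s (h j (Finset.mem_univ j))
  | .eq t u, d, h => by
      simp only [Fm.bcount, Nat.add_eq_zero_iff] at h
      simp only [Fm.inst, Tm.inst_of_bcount_eq_zero s h.1, Tm.inst_of_bcount_eq_zero s h.2]
  | .bot, _, _ | .top, _, _ => by simp [Fm.inst]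
  | .neg A, d, h => by
      simp only [Fm.bcount] at h
      simp only [Fm.inst, Fm.inst_of_bcount_eq_zero s h]
  | .and A B, d, h | .or A B, d, h | .imp A B, d, h | .iff A B, d, h => by
      simp only [Fm.bcount, Nat.add_eq_zero_iff] at h
      simp only [Fm.inst, Fm.inst_of_bcount_eq_zero s h.1, Fm.inst_of_bcount_eq_zero s h.2]

end

mutual

theorem Tm.bcount_inst {s : Tm} (hs : s.WF) :
    ∀ (t : Tm) {c d : ℕ}, c ≠ d → (Tm.inst s t d).bcount c = t.bcount c
  | .fvar _, _, _, _ => by simp [Tm.inst]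
  | .bvar b, c, d, h => by
      simp only [Tm.inst]
      split_ifs with hb
      · subst hb
        rw [hs.bcount]
        simp [Tm.bcount, h.symm]
      · rfl
  | .fn n i ts, c, d, h => by
      simp only [Tm.inst, Tm.bcount, Tm.bcount_inst hs (ts _) h]
  | .eps A, c, d, h => by
      simp only [Tm.inst, Tm.bcount]
      exact Fm.bcount_inst hs A (by omega)

theorem Fm.bcount_inst {s : Tm} (hs : s.WF) :
    ∀ (A : Fm) {c d : ℕ}, c ≠ d → (Fm.inst s A d).bcount c = A.bcount c
  | .pred n i ts, c, d, h => by
      simp only [Fm.inst, Fm.bcount, Tm.bcount_inst hs (ts _) h]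
  | .eq t u, c, d, h => by
      simp only [Fm.inst, Fm.bcount, Tm.bcount_inst hs t h, Tm.bcount_inst hs u h]
  | .bot, _, _, _ | .top, _, _, _ => by simp [Fm.inst]
  | .neg A, c, d, h => by
      simp only [Fm.inst, Fm.bcount, Fm.bcount_inst hs A h]
  | .and A B, c, d, h | .or A B, c, d, h | .imp A B, c, d, h | .iff A B, c, d, h => by
      simp only [Fm.inst, Fm.bcount, Fm.bcount_inst hs A h, Fm.bcount_inst hs B h]

end

mutual

theorem Tm.subRank_inst {s : Tm} (hs : s.WF) :
    ∀ (t : Tm) {c d : ℕ}, c ≠ d → (Tm.inst s t d).subRank c = t.subRank c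
  | .fvar _, _, _, _ => by simp [Tm.inst]
  | .bvar b, c, d, h => by
      simp only [Tm.inst]
      split_ifs with hb
      · rw [hs.subRank]
        simp [Tm.subRank]
      · rfl
  | .fn n i ts, c, d, h => by
      simp only [Tm.inst, Tm.subRank, Tm.subRank_inst hs (ts _) h]
  | .eps A, c, d, h => by
      simp only [Tm.inst, Tm.subRank]
      rw [Fm.subRank_inst hs A (show c + 1 ≠ d + 1 by omega),
        Fm.subRank_inst hs A (show 0 ≠ d + 1 by omega),
        Fm.bcount_inst hs A (show c + 1 ≠ d + 1 by omega)]

theorem Fm.subRank_inst {s : Tm} (hs : s.WF) :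
    ∀ (A : Fm) {c d : ℕ}, c ≠ d → (Fm.inst s A d).subRank c = A.subRank c
  | .pred n i ts, c, d, h => by
      simp only [Fm.inst, Fm.subRank, Tm.subRank_inst hs (ts _) h]
  | .eq t u, c, d, h => by
      simp only [Fm.inst, Fm.subRank, Tm.subRank_inst hs t h, Tm.subRank_inst hs u h]
  | .bot, _, _, _ | .top, _, _, _ => by simp [Fm.inst]
  | .neg A, c, d, h => by
      simp only [Fm.inst, Fm.subRank, Fm.subRank_inst hs A h]
  | .and A B, c, d, h | .or A B, c, d, h | .imp A B, c, d, h | .iff A B, c, d, h => by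
      simp only [Fm.inst, Fm.subRank, Fm.subRank_inst hs A h, Fm.subRank_inst hs B h]

end

mutual

theorem Tm.bcount_subst {σ : ℕ → Tm} (hσ : ∀ y, (σ y).WF) :
    ∀ (t : Tm) (d : ℕ), (t.subst σ).bcount d = t.bcount d
  | .fvar x, d => by simp [Tm.subst, Tm.bcount, (hσ x).bcount]
  | .bvar _, _ => by simp [Tm.subst]
  | .fn n i ts, d => by simp only [Tm.subst, Tm.bcount, Tm.bcount_subst hσ (ts _)]
  | .eps A, d => by simp only [Tm.subst, Tm.bcount, Fm.bcount_subst hσ A]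

theorem Fm.bcount_subst {σ : ℕ → Tm} (hσ : ∀ y, (σ y).WF) :
    ∀ (A : Fm) (d : ℕ), (A.subst σ).bcount d = A.bcount d
  | .pred n i ts, d => by simp only [Fm.subst, Fm.bcount, Tm.bcount_subst hσ (ts _)]
  | .eq t u, d => by
      simp only [Fm.subst, Fm.bcount, Tm.bcount_subst hσ t, Tm.bcount_subst hσ u]
  | .bot, _ | .top, _ => by simp [Fm.subst]
  | .neg A, d => by simp only [Fm.subst, Fm.bcount, Fm.bcount_subst hσ A]
  | .and A B, d | .or A B, d | .imp A B, d | .iff A B, d => by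
      simp only [Fm.subst, Fm.bcount, Fm.bcount_subst hσ A, Fm.bcount_subst hσ B]

end

mutual

theorem Tm.subRank_subst {σ : ℕ → Tm} (hσ : ∀ y, (σ y).WF) :
    ∀ (t : Tm) (d : ℕ), (t.subst σ).subRank d = t.subRank d
  | .fvar x, d => by simp [Tm.subst, Tm.subRank, (hσ x).subRank]
  | .bvar _, _ => by simp [Tm.subst]
  | .fn n i ts, d => by simp only [Tm.subst, Tm.subRank, Tm.subRank_subst hσ (ts _)]
  | .eps A, d => by
      simp only [Tm.subst, Tm.subRank, Fm.subRank_subst hσ A, Fm.bcount_subst hσ A]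

theorem Fm.subRank_subst {σ : ℕ → Tm} (hσ : ∀ y, (σ y).WF) :
    ∀ (A : Fm) (d : ℕ), (A.subst σ).subRank d = A.subRank d
  | .pred n i ts, d => by simp only [Fm.subst, Fm.subRank, Tm.subRank_subst hσ (ts _)]
  | .eq t u, d => by
      simp only [Fm.subst, Fm.subRank, Tm.subRank_subst hσ t, Tm.subRank_subst hσ u]
  | .bot, _ | .top, _ => by simp [Fm.subst]
  | .neg A, d => by simp only [Fm.subst, Fm.subRank, Fm.subRank_subst hσ A]
  | .and A B, d | .or A B, d | .imp A B, d | .iff A B, d => by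
      simp only [Fm.subst, Fm.subRank, Fm.subRank_subst hσ A, Fm.subRank_subst hσ B]

end

mutual

theorem Tm.wfAt_subst {σ : ℕ → Tm} (hσ : ∀ y, (σ y).WF) :
    ∀ (t : Tm) (d : ℕ), (t.subst σ).WFAt d ↔ t.WFAt d
  | .fvar x, d => by simp [Tm.subst, Tm.WFAt, (hσ x).wfAt]
  | .bvar _, _ => by simp [Tm.subst]
  | .fn n i ts, d => by simp only [Tm.subst, Tm.WFAt, Tm.wfAt_subst hσ (ts _)]
  | .eps A, d => by
      simp only [Tm.subst, Tm.WFAt, Fm.wfAt_subst hσ A, Fm.bcount_subst hσ A]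

theorem Fm.wfAt_subst {σ : ℕ → Tm} (hσ : ∀ y, (σ y).WF) :
    ∀ (A : Fm) (d : ℕ), (A.subst σ).WFAt d ↔ A.WFAt d
  | .pred n i ts, d => by simp only [Fm.subst, Fm.WFAt, Tm.wfAt_subst hσ (ts _)]
  | .eq t u, d => by
      simp only [Fm.subst, Fm.WFAt, Tm.wfAt_subst hσ t, Tm.wfAt_subst hσ u]
  | .bot, _ | .top, _ => by simp [Fm.subst]
  | .neg A, d => by simp only [Fm.subst, Fm.WFAt, Fm.wfAt_subst hσ A]
  | .and A B, d | .or A B, d | .imp A B, d | .iff A B, d => by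
      simp only [Fm.subst, Fm.WFAt, Fm.wfAt_subst hσ A, Fm.wfAt_subst hσ B]

end

theorem Tm.wf_subst {σ : ℕ → Tm} (hσ : ∀ y, (σ y).WF) (t : Tm) : (t.subst σ).WF ↔ t.WF :=
  Tm.wfAt_subst hσ t 0

theorem Tm.rank_subst_eps {σ : ℕ → Tm} (hσ : ∀ y, (σ y).WF) (A : Fm) :
    ((Tm.eps A).subst σ).rank = (Tm.eps A).rank := by
  simp only [Tm.subst, Tm.rank, Fm.subRank_subst hσ]

mutual

theorem Tm.subst_congr {σ τ : ℕ → Tm} :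
    ∀ (t : Tm), (∀ y, 0 < t.count y → σ y = τ y) → t.subst σ = t.subst τ
  | .fvar x, h => h x (by simp [Tm.count])
  | .bvar _, _ => by simp [Tm.subst]
  | .fn n i ts, h => by
      simp only [Tm.subst]
      congr 1
      funext j
      refine Tm.subst_congr (ts j) fun y hy => h y ?_
      simp only [Tm.count]
      exact hy.trans_le (Finset.single_le_sum (f := fun j => (ts j).count y)
        (fun _ _ => Nat.zero_le _) (Finset.mem_univ j))
  | .eps A, h => by
      simp only [Tm.subst]
      rw [Fm.subst_congr A fun y hy => h y (by simpa only [Tm.count] using hy)]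

theorem Fm.subst_congr {σ τ : ℕ → Tm} :
    ∀ (A : Fm), (∀ y, 0 < A.count y → σ y = τ y) → A.subst σ = A.subst τ
  | .pred n i ts, h => by
      simp only [Fm.subst]
      congr 1
      funext j
      refine Tm.subst_congr (ts j) fun y hy => h y ?_
      simp only [Fm.count]
      exact hy.trans_le (Finset.single_le_sum (f := fun j => (ts j).count y)
        (fun _ _ => Nat.zero_le _) (Finset.mem_univ j))
  | .eq t u, h => by
      simp only [Fm.subst]
      rw [Tm.subst_congr t fun y hy => h y (by simp only [Fm.count]; omega),
        Tm.subst_congr u fun y hy => h y (by simp only [Fm.count]; omega)]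
  | .bot, _ | .top, _ => by simp [Fm.subst]
  | .neg A, h => by
      simp only [Fm.subst]
      rw [Fm.subst_congr A fun y hy => h y (by simpa only [Fm.count] using hy)]
  | .and A B, h | .or A B, h | .imp A B, h | .iff A B, h => by
      simp only [Fm.subst]
      rw [Fm.subst_congr A fun y hy => h y (by simp only [Fm.count]; omega),
        Fm.subst_congr B fun y hy => h y (by simp only [Fm.count]; omega)]

end

mutual

theorem Tm.subst_subst (σ τ : ℕ → Tm) :
    ∀ t : Tm, (t.subst σ).subst τ = t.subst fun y => (σ y).subst τ
  | .fvar x | .bvar _ => by simp [Tm.subst]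
  | .fn n i ts => by simp only [Tm.subst, Tm.subst_subst σ τ (ts _)]
  | .eps A => by simp only [Tm.subst, Fm.subst_subst σ τ A]

theorem Fm.subst_subst (σ τ : ℕ → Tm) :
    ∀ A : Fm, (A.subst σ).subst τ = A.subst fun y => (σ y).subst τ
  | .pred n i ts => by simp only [Fm.subst, Tm.subst_subst σ τ (ts _)]
  | .eq t u => by simp only [Fm.subst, Tm.subst_subst σ τ t, Tm.subst_subst σ τ u]
  | .bot | .top => by simp [Fm.subst]
  | .neg A => by simp only [Fm.subst, Fm.subst_subst σ τ A]
  | .and A B | .or A B | .imp A B | .iff A B => by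
      simp only [Fm.subst, Fm.subst_subst σ τ A, Fm.subst_subst σ τ B]

end

mutual

theorem Tm.subst_fvar : ∀ t : Tm, t.subst Tm.fvar = t
  | .fvar x | .bvar _ => by simp [Tm.subst]
  | .fn n i ts => by simp only [Tm.subst, Tm.subst_fvar (ts _)]
  | .eps A => by simp only [Tm.subst, Fm.subst_fvar A]

theorem Fm.subst_fvar : ∀ A : Fm, A.subst Tm.fvar = A
  | .pred n i ts => by simp only [Fm.subst, Tm.subst_fvar (ts _)]
  | .eq t u => by simp only [Fm.subst, Tm.subst_fvar t, Tm.subst_fvar u]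
  | .bot | .top => by simp [Fm.subst]
  | .neg A => by simp only [Fm.subst, Fm.subst_fvar A]
  | .and A B | .or A B | .imp A B | .iff A B => by
      simp only [Fm.subst, Fm.subst_fvar A, Fm.subst_fvar B]

end

mutual

theorem Tm.exists_count_eq_zero : ∀ t : Tm, ∃ N, ∀ y, N ≤ y → t.count y = 0
  | .fvar x => ⟨x + 1, fun y hy => by simp only [Tm.count]; split_ifs <;> omega⟩
  | .bvar _ => ⟨0, fun y _ => by simp [Tm.count]⟩
  | .fn n i ts => by
      choose N hN using fun j => Tm.exists_count_eq_zero (ts j)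
      refine ⟨Finset.univ.sup N, fun y hy => ?_⟩
      simp only [Tm.count]
      exact Finset.sum_eq_zero fun j hj => hN j y ((Finset.le_sup hj).trans hy)
  | .eps A => by
      obtain ⟨N, hN⟩ := Fm.exists_count_eq_zero A
      exact ⟨N, fun y hy => by simp only [Tm.count, hN y hy]⟩

theorem Fm.exists_count_eq_zero : ∀ A : Fm, ∃ N, ∀ y, N ≤ y → A.count y = 0
  | .pred n i ts => by
      choose N hN using fun j => Tm.exists_count_eq_zero (ts j)
      refine ⟨Finset.univ.sup N, fun y hy => ?_⟩
      simp only [Fm.count]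
      exact Finset.sum_eq_zero fun j hj => hN j y ((Finset.le_sup hj).trans hy)
  | .eq t u => by
      obtain ⟨N, hN⟩ := Tm.exists_count_eq_zero t
      obtain ⟨M, hM⟩ := Tm.exists_count_eq_zero u
      exact ⟨max N M, fun y hy => by
        simp only [Fm.count, hN y (by omega), hM y (by omega)]⟩
  | .bot | .top => ⟨0, fun y _ => by simp [Fm.count]⟩
  | .neg A => by
      obtain ⟨N, hN⟩ := Fm.exists_count_eq_zero A
      exact ⟨N, fun y hy => by simp only [Fm.count, hN y hy]⟩
  | .and A B | .or A B | .imp A B | .iff A B => by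
      obtain ⟨N, hN⟩ := Fm.exists_count_eq_zero A
      obtain ⟨M, hM⟩ := Fm.exists_count_eq_zero B
      exact ⟨max N M, fun y hy => by
        simp only [Fm.count, hN y (by omega), hM y (by omega)]⟩

end

/-! ### `ε`-types as linear terms without proper closed subterms other than variables -/

mutual

/-- Every subexpression that is a term of the language is a free variable. -/
def Tm.Skel : Tm → Prop
  | .fvar _ => True
  | .bvar _ => True
  | .fn n i ts => ¬ (Tm.fn n i ts).WF ∧ ∀ j, Tm.Skel (ts j)
  | .eps A => ¬ (Tm.eps A).WF ∧ Fm.Skel A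

/-- Every subexpression that is a term of the language is a free variable. -/
def Fm.Skel : Fm → Prop
  | .pred _ _ ts => ∀ j, Tm.Skel (ts j)
  | .eq t u => Tm.Skel t ∧ Tm.Skel u
  | .bot => True
  | .top => True
  | .neg A => Fm.Skel A
  | .and A B => Fm.Skel A ∧ Fm.Skel B
  | .or A B => Fm.Skel A ∧ Fm.Skel B
  | .imp A B => Fm.Skel A ∧ Fm.Skel B
  | .iff A B => Fm.Skel A ∧ Fm.Skel B

end

theorem Tm.Skel.exists_eq_fvar {t : Tm} (h : t.Skel) (hw : t.WF) : ∃ y, t = .fvar y := by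
  cases t with
  | fvar y => exact ⟨y, rfl⟩
  | bvar d => exact absurd hw (Tm.not_wf_bvar d)
  | fn n i ts => simp only [Tm.Skel] at h; exact absurd hw h.1
  | eps A => simp only [Tm.Skel] at h; exact absurd hw h.1

mutual

theorem Tm.Skel.rename (f : ℕ → ℕ) :
    ∀ {t : Tm}, t.Skel → (t.subst fun y => .fvar (f y)).Skel
  | .fvar x, _ | .bvar _, _ => by simp [Tm.subst, Tm.Skel]
  | .fn n i ts, h => by
      simp only [Tm.Skel] at h
      refine (show (Tm.Skel (.fn n i _)) from ?_)
      simp only [Tm.Skel]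
      refine ⟨fun hw => h.1 ((Tm.wf_subst (fun y => Tm.wf_fvar (f y)) (.fn n i ts)).1 ?_),
        fun j => Tm.Skel.rename f (h.2 j)⟩
      simpa only [Tm.subst] using hw
  | .eps A, h => by
      simp only [Tm.Skel] at h
      refine (show (Tm.Skel (.eps _)) from ?_)
      simp only [Tm.Skel]
      refine ⟨fun hw => h.1 ((Tm.wf_subst (fun y => Tm.wf_fvar (f y)) (.eps A)).1 ?_),
        Fm.Skel.rename f h.2⟩
      simpa only [Tm.subst] using hw

theorem Fm.Skel.rename (f : ℕ → ℕ) :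
    ∀ {A : Fm}, A.Skel → (A.subst fun y => .fvar (f y)).Skel
  | .pred n i ts, h => by
      simp only [Fm.Skel] at h
      simp only [Fm.subst, Fm.Skel]
      exact fun j => Tm.Skel.rename f (h j)
  | .eq t u, h => by
      simp only [Fm.Skel] at h
      simp only [Fm.subst, Fm.Skel]
      exact ⟨Tm.Skel.rename f h.1, Tm.Skel.rename f h.2⟩
  | .bot, _ | .top, _ => by simp [Fm.subst, Fm.Skel]
  | .neg A, h => by
      simp only [Fm.Skel] at h
      simp only [Fm.subst, Fm.Skel]
      exact Fm.Skel.rename f h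
  | .and A B, h | .or A B, h | .imp A B, h | .iff A B, h => by
      simp only [Fm.Skel] at h
      simp only [Fm.subst, Fm.Skel]
      exact ⟨Fm.Skel.rename f h.1, Fm.Skel.rename f h.2⟩

end

mutual

theorem Tm.count_rename {f : ℕ → ℕ} (hf : f.Injective) (y : ℕ) :
    ∀ t : Tm, (t.subst fun y => .fvar (f y)).count (f y) = t.count y
  | .fvar x | .bvar _ => by simp [Tm.subst, Tm.count, hf.eq_iff]
  | .fn n i ts => by simp only [Tm.subst, Tm.count, Tm.count_rename hf y (ts _)]
  | .eps A => by simp only [Tm.subst, Tm.count, Fm.count_rename hf y A]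

theorem Fm.count_rename {f : ℕ → ℕ} (hf : f.Injective) (y : ℕ) :
    ∀ A : Fm, (A.subst fun y => .fvar (f y)).count (f y) = A.count y
  | .pred n i ts => by simp only [Fm.subst, Fm.count, Tm.count_rename hf y (ts _)]
  | .eq t u => by simp only [Fm.subst, Fm.count, Tm.count_rename hf y t, Tm.count_rename hf y u]
  | .bot | .top => by simp [Fm.subst, Fm.count]
  | .neg A => by simp only [Fm.subst, Fm.count, Fm.count_rename hf y A]
  | .and A B | .or A B | .imp A B | .iff A B => by
      simp only [Fm.subst, Fm.count, Fm.count_rename hf y A, Fm.count_rename hf y B]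

end

mutual

theorem Tm.count_rename_of_notMem {f : ℕ → ℕ} {z : ℕ} (hz : ∀ y, f y ≠ z) :
    ∀ t : Tm, (t.subst fun y => .fvar (f y)).count z = 0
  | .fvar x | .bvar _ => by simp [Tm.subst, Tm.count, hz]
  | .fn n i ts => by simp [Tm.subst, Tm.count, Tm.count_rename_of_notMem hz (ts _)]
  | .eps A => by simp only [Tm.subst, Tm.count, Fm.count_rename_of_notMem hz A]

theorem Fm.count_rename_of_notMem {f : ℕ → ℕ} {z : ℕ} (hz : ∀ y, f y ≠ z) :
    ∀ A : Fm, (A.subst fun y => .fvar (f y)).count z = 0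
  | .pred n i ts => by simp [Fm.subst, Fm.count, Tm.count_rename_of_notMem hz (ts _)]
  | .eq t u => by
      simp only [Fm.subst, Fm.count, Tm.count_rename_of_notMem hz t,
        Tm.count_rename_of_notMem hz u]
  | .bot | .top => by simp [Fm.subst, Fm.count]
  | .neg A => by simp only [Fm.subst, Fm.count, Fm.count_rename_of_notMem hz A]
  | .and A B | .or A B | .imp A B | .iff A B => by
      simp only [Fm.subst, Fm.count, Fm.count_rename_of_notMem hz A,
        Fm.count_rename_of_notMem hz B]

end

mutual

theorem Tm.count_subst_pos {σ : ℕ → Tm} {x y : ℕ} (hy : 0 < (σ x).count y) :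
    ∀ {t : Tm}, 0 < t.count x → 0 < (t.subst σ).count y
  | .fvar z, h => by
      simp only [Tm.count] at h
      split_ifs at h with hz
      · subst hz; simpa only [Tm.subst] using hy
      · omega
  | .bvar _, h => by simp [Tm.count] at h
  | .fn n i ts, h => by
      simp only [Tm.count] at h
      obtain ⟨j, _, hj⟩ := Finset.exists_ne_zero_of_sum_ne_zero h.ne'
      simp only [Tm.subst, Tm.count]
      exact (Tm.count_subst_pos hy (Nat.pos_of_ne_zero hj)).trans_le
        (Finset.single_le_sum (f := fun j => ((ts j).subst σ).count y)
          (fun _ _ => Nat.zero_le _) (Finset.mem_univ j))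
  | .eps A, h => by
      simp only [Tm.count] at h
      simp only [Tm.subst, Tm.count]
      exact Fm.count_subst_pos hy h

theorem Fm.count_subst_pos {σ : ℕ → Tm} {x y : ℕ} (hy : 0 < (σ x).count y) :
    ∀ {A : Fm}, 0 < A.count x → 0 < (A.subst σ).count y
  | .pred n i ts, h => by
      simp only [Fm.count] at h
      obtain ⟨j, _, hj⟩ := Finset.exists_ne_zero_of_sum_ne_zero h.ne'
      simp only [Fm.subst, Fm.count]
      exact (Tm.count_subst_pos hy (Nat.pos_of_ne_zero hj)).trans_le
        (Finset.single_le_sum (f := fun j => ((ts j).subst σ).count y)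
          (fun _ _ => Nat.zero_le _) (Finset.mem_univ j))
  | .eq t u, h => by
      simp only [Fm.count, Nat.add_pos_iff_pos_or_pos] at h
      simp only [Fm.subst, Fm.count, Nat.add_pos_iff_pos_or_pos]
      exact h.imp (Tm.count_subst_pos hy) (Tm.count_subst_pos hy)
  | .bot, h | .top, h => by simp [Fm.count] at h
  | .neg A, h => by
      simp only [Fm.count] at h
      simp only [Fm.subst, Fm.count]
      exact Fm.count_subst_pos hy h
  | .and A B, h | .or A B, h | .imp A B, h | .iff A B, h => by
      simp only [Fm.count, Nat.add_pos_iff_pos_or_pos] at h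
      simp only [Fm.subst, Fm.count, Nat.add_pos_iff_pos_or_pos]
      exact h.imp (Fm.count_subst_pos hy) (Fm.count_subst_pos hy)

end

mutual

theorem Tm.Skel.of_subst {σ : ℕ → Tm} {x : ℕ} :
    ∀ {t : Tm}, (t.subst σ).Skel → 0 < t.count x → (σ x).Skel
  | .fvar z, hs, h => by
      simp only [Tm.count] at h
      split_ifs at h with hz
      · subst hz; simpa only [Tm.subst] using hs
      · omega
  | .bvar _, _, h => by simp [Tm.count] at h
  | .fn n i ts, hs, h => by
      simp only [Tm.count] at h
      obtain ⟨j, _, hj⟩ := Finset.exists_ne_zero_of_sum_ne_zero h.ne'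
      simp only [Tm.subst, Tm.Skel] at hs
      exact Tm.Skel.of_subst (hs.2 j) (Nat.pos_of_ne_zero hj)
  | .eps A, hs, h => by
      simp only [Tm.count] at h
      simp only [Tm.subst, Tm.Skel] at hs
      exact Fm.Skel.of_subst hs.2 h

theorem Fm.Skel.of_subst {σ : ℕ → Tm} {x : ℕ} :
    ∀ {A : Fm}, (A.subst σ).Skel → 0 < A.count x → (σ x).Skel
  | .pred n i ts, hs, h => by
      simp only [Fm.count] at h
      obtain ⟨j, _, hj⟩ := Finset.exists_ne_zero_of_sum_ne_zero h.ne'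
      simp only [Fm.subst, Fm.Skel] at hs
      exact Tm.Skel.of_subst (hs j) (Nat.pos_of_ne_zero hj)
  | .eq t u, hs, h => by
      simp only [Fm.count, Nat.add_pos_iff_pos_or_pos] at h
      simp only [Fm.subst, Fm.Skel] at hs
      exact h.elim (Tm.Skel.of_subst hs.1) (Tm.Skel.of_subst hs.2)
  | .bot, _, h | .top, _, h => by simp [Fm.count] at h
  | .neg A, hs, h => by
      simp only [Fm.count] at h
      simp only [Fm.subst, Fm.Skel] at hs
      exact Fm.Skel.of_subst hs h
  | .and A B, hs, h | .or A B, hs, h | .imp A B, hs, h | .iff A B, hs, h => by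
      simp only [Fm.count, Nat.add_pos_iff_pos_or_pos] at h
      simp only [Fm.subst, Fm.Skel] at hs
      exact h.elim (Fm.Skel.of_subst hs.1) (Fm.Skel.of_subst hs.2)

end

theorem eq_fvar_of_properSubterm {P : Fm} (hP : P.Skel) {t : Tm}
    (h : ProperSubterm t (.eps P)) : ∃ y, 0 < (Tm.eps P).count y ∧ t = .fvar y := by
  obtain ⟨⟨ht, s, x, -, hx, hs⟩, hne⟩ := h
  cases s with
  | fvar z =>
    simp only [Tm.count] at hx
    split_ifs at hx with hz
    · subst hz
      simp [Tm.subst] at hs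
      exact absurd hs.symm hne
    · omega
  | bvar d => simp [Tm.count] at hx
  | fn n i ts => simp [Tm.subst] at hs
  | eps B =>
    simp only [Tm.subst, Tm.eps.injEq] at hs
    simp only [Tm.count] at hx
    have h1 := Fm.Skel.of_subst (hs ▸ hP) hx
    rw [Function.update_self] at h1
    obtain ⟨y, rfl⟩ := h1.exists_eq_fvar ht
    refine ⟨y, ?_, rfl⟩
    simp only [Tm.count]
    rw [hs]
    exact Fm.count_subst_pos (x := x) (by simp [Tm.count]) hx

theorem isEpsType_of_skel {P : Fm} (hw : (Tm.eps P).WF) (hP : P.Skel)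
    (hlin : ∀ x, P.count x ≤ 1) : IsEpsType (.eps P) := by
  refine ⟨hw, ⟨P, rfl⟩, fun t => ⟨fun h => eq_fvar_of_properSubterm hP h.1, ?_⟩, fun x => ?_⟩
  · rintro ⟨x, hx, rfl⟩
    refine ⟨⟨⟨Tm.wf_fvar x, .eps P, x, hw, hx, ?_⟩, by simp⟩, ?_⟩
    · rw [Function.update_eq_self, Tm.subst_fvar]
    · rintro ⟨u, hu, ⟨-, s, z, -, hz, hs⟩, hne⟩
      obtain ⟨y, -, rfl⟩ := eq_fvar_of_properSubterm hP hu
      cases s with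
      | fvar w =>
        simp only [Tm.count] at hz
        split_ifs at hz with hw
        · subst hw
          simp [Tm.subst] at hs
          simp [hs] at hne
        · omega
      | bvar d => simp [Tm.subst] at hs
      | fn n i ts => simp [Tm.subst] at hs
      | eps B => simp [Tm.subst] at hs
  · simpa only [Tm.count] using hlin x

/-! ### Occurrences of terms, and overlaps between axiom schemas -/

mutual

/-- Number of symbols other than bound variables. -/
def Tm.weight : Tm → ℕ
  | .fvar _ => 1
  | .bvar _ => 0
  | .fn _ _ ts => 1 + ∑ j, Tm.weight (ts j)
  | .eps A => 1 + Fm.weight A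

/-- Number of symbols other than bound variables. -/
def Fm.weight : Fm → ℕ
  | .pred _ _ ts => 1 + ∑ j, Tm.weight (ts j)
  | .eq t u => 1 + Tm.weight t + Tm.weight u
  | .bot => 1
  | .top => 1
  | .neg A => 1 + Fm.weight A
  | .and A B => 1 + Fm.weight A + Fm.weight B
  | .or A B => 1 + Fm.weight A + Fm.weight B
  | .imp A B => 1 + Fm.weight A + Fm.weight B
  | .iff A B => 1 + Fm.weight A + Fm.weight B

end

mutual

/-- The raw term `s` occurs in the expression. -/
def Tm.Occ (s : Tm) : Tm → Prop
  | .fvar x => s = .fvar x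
  | .bvar d => s = .bvar d
  | .fn n i ts => s = .fn n i ts ∨ ∃ j, Tm.Occ s (ts j)
  | .eps A => s = .eps A ∨ Fm.Occ s A

/-- The raw term `s` occurs in the expression. -/
def Fm.Occ (s : Tm) : Fm → Prop
  | .pred _ _ ts => ∃ j, Tm.Occ s (ts j)
  | .eq t u => Tm.Occ s t ∨ Tm.Occ s u
  | .bot => False
  | .top => False
  | .neg A => Fm.Occ s A
  | .and A B => Fm.Occ s A ∨ Fm.Occ s B
  | .or A B => Fm.Occ s A ∨ Fm.Occ s B
  | .imp A B => Fm.Occ s A ∨ Fm.Occ s B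
  | .iff A B => Fm.Occ s A ∨ Fm.Occ s B

end

theorem Tm.Occ.refl (t : Tm) : Tm.Occ t t := by
  cases t <;> simp [Tm.Occ]

theorem Tm.WF.weight_pos {t : Tm} (h : t.WF) : 0 < t.weight := by
  cases t with
  | bvar d => exact absurd h (Tm.not_wf_bvar d)
  | _ => simp only [Tm.weight]; omega

mutual

theorem Tm.Occ.weight_le {s : Tm} : ∀ {t : Tm}, Tm.Occ s t → s.weight ≤ t.weight
  | .fvar x, h | .bvar x, h => by simp only [Tm.Occ] at h; rw [h]
  | .fn n i ts, h => by
      rcases h with rfl | ⟨j, h⟩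
      · exact le_rfl
      · have h1 := Tm.Occ.weight_le h
        have := Finset.single_le_sum (f := fun j => (ts j).weight) (fun _ _ => Nat.zero_le _)
          (Finset.mem_univ j)
        simp only [Tm.weight] at this ⊢
        omega
  | .eps A, h => by
      rcases h with rfl | h
      · exact le_rfl
      · have h1 := Fm.Occ.weight_le h
        simp only [Tm.weight]
        omega

theorem Fm.Occ.weight_le {s : Tm} : ∀ {A : Fm}, Fm.Occ s A → s.weight ≤ A.weight
  | .pred n i ts, ⟨j, h⟩ => by
      have h1 := Tm.Occ.weight_le h
      have := Finset.single_le_sum (f := fun j => (ts j).weight) (fun _ _ => Nat.zero_le _)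
        (Finset.mem_univ j)
      simp only [Fm.weight] at this ⊢
      omega
  | .eq t u, h => by
      simp only [Fm.weight]
      rcases h with h | h
      · have := Tm.Occ.weight_le h
        omega
      · have := Tm.Occ.weight_le h
        omega
  | .bot, h | .top, h => by simp [Fm.Occ] at h
  | .neg A, h => by
      have := Fm.Occ.weight_le (A := A) h
      simp only [Fm.weight]
      omega
  | .and A B, h | .or A B, h | .imp A B, h | .iff A B, h => by
      simp only [Fm.weight]
      rcases h with h | h
      · have := Fm.Occ.weight_le h
        omega
      · have := Fm.Occ.weight_le h
        omega

end

mutual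

theorem Tm.weight_inst (s : Tm) :
    ∀ (t : Tm) (d : ℕ), (Tm.inst s t d).weight = t.weight + t.bcount d * s.weight
  | .fvar _, _ => by simp [Tm.inst, Tm.bcount]
  | .bvar c, d => by
      by_cases h : c = d <;> simp [Tm.inst, Tm.bcount, Tm.weight, h]
  | .fn n i ts, d => by
      simp only [Tm.inst, Tm.weight, Tm.bcount, Tm.weight_inst s (ts _) d, Finset.sum_add_distrib,
        Finset.sum_mul]
      ring
  | .eps A, d => by
      simp only [Tm.inst, Tm.weight, Tm.bcount, Fm.weight_inst s A (d + 1)]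
      ring

theorem Fm.weight_inst (s : Tm) :
    ∀ (A : Fm) (d : ℕ), (Fm.inst s A d).weight = A.weight + A.bcount d * s.weight
  | .pred n i ts, d => by
      simp only [Fm.inst, Fm.weight, Fm.bcount, Tm.weight_inst s (ts _) d, Finset.sum_add_distrib,
        Finset.sum_mul]
      ring
  | .eq t u, d => by
      simp only [Fm.inst, Fm.weight, Fm.bcount, Tm.weight_inst s t d, Tm.weight_inst s u d]
      ring
  | .bot, _ | .top, _ => by simp [Fm.inst, Fm.bcount]
  | .neg A, d => by
      simp only [Fm.inst, Fm.weight, Fm.bcount, Fm.weight_inst s A d]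
      ring
  | .and A B, d | .or A B, d | .imp A B, d | .iff A B, d => by
      simp only [Fm.inst, Fm.weight, Fm.bcount, Fm.weight_inst s A d, Fm.weight_inst s B d]
      ring

end

mutual

theorem Tm.occ_inst (s : Tm) :
    ∀ {t : Tm} {d : ℕ}, 0 < t.bcount d → Tm.Occ s (Tm.inst s t d)
  | .fvar _, _, h => by simp [Tm.bcount] at h
  | .bvar c, d, h => by
      simp only [Tm.bcount] at h
      split_ifs at h with hc
      · simp only [Tm.inst, hc, if_true]
        exact .refl s
      · omega
  | .fn n i ts, d, h => by
      simp only [Tm.bcount] at h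
      obtain ⟨j, _, hj⟩ := Finset.exists_ne_zero_of_sum_ne_zero h.ne'
      exact .inr ⟨j, Tm.occ_inst s (Nat.pos_of_ne_zero hj)⟩
  | .eps A, d, h => .inr (Fm.occ_inst s (A := A) (d := d + 1) h)

theorem Fm.occ_inst (s : Tm) :
    ∀ {A : Fm} {d : ℕ}, 0 < A.bcount d → Fm.Occ s (Fm.inst s A d)
  | .pred n i ts, d, h => by
      simp only [Fm.bcount] at h
      obtain ⟨j, _, hj⟩ := Finset.exists_ne_zero_of_sum_ne_zero h.ne'
      exact ⟨j, Tm.occ_inst s (Nat.pos_of_ne_zero hj)⟩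
  | .eq t u, d, h => by
      simp only [Fm.bcount, Nat.add_pos_iff_pos_or_pos] at h
      exact h.imp (Tm.occ_inst s) (Tm.occ_inst s)
  | .bot, _, h | .top, _, h => by simp [Fm.bcount] at h
  | .neg A, d, h => Fm.occ_inst s (A := A) h
  | .and A B, d, h | .or A B, d, h | .imp A B, d, h | .iff A B, d, h => by
      simp only [Fm.bcount, Nat.add_pos_iff_pos_or_pos] at h
      exact h.imp (Fm.occ_inst s) (Fm.occ_inst s)

end

mutual

theorem Tm.occ_subst {σ : ℕ → Tm} {x : ℕ} :
    ∀ {t : Tm}, 0 < t.count x → Tm.Occ (σ x) (t.subst σ)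
  | .fvar z, h => by
      simp only [Tm.count] at h
      split_ifs at h with hz
      · subst hz; exact .refl _
      · omega
  | .bvar _, h => by simp [Tm.count] at h
  | .fn n i ts, h => by
      simp only [Tm.count] at h
      obtain ⟨j, _, hj⟩ := Finset.exists_ne_zero_of_sum_ne_zero h.ne'
      exact .inr ⟨j, Tm.occ_subst (Nat.pos_of_ne_zero hj)⟩
  | .eps A, h => .inr (Fm.occ_subst (A := A) h)

theorem Fm.occ_subst {σ : ℕ → Tm} {x : ℕ} :
    ∀ {A : Fm}, 0 < A.count x → Fm.Occ (σ x) (A.subst σ)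
  | .pred n i ts, h => by
      simp only [Fm.count] at h
      obtain ⟨j, _, hj⟩ := Finset.exists_ne_zero_of_sum_ne_zero h.ne'
      exact ⟨j, Tm.occ_subst (Nat.pos_of_ne_zero hj)⟩
  | .eq t u, h => by
      simp only [Fm.count, Nat.add_pos_iff_pos_or_pos] at h
      exact h.imp Tm.occ_subst Tm.occ_subst
  | .bot, h | .top, h => by simp [Fm.count] at h
  | .neg A, h => Fm.occ_subst (A := A) h
  | .and A B, h | .or A B, h | .imp A B, h | .iff A B, h => by
      simp only [Fm.count, Nat.add_pos_iff_pos_or_pos] at h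
      exact h.imp Fm.occ_subst Fm.occ_subst

end

mutual

theorem Tm.EpsFree.not_occ {A : Fm} : ∀ {t : Tm}, t.EpsFree → ¬ Tm.Occ (.eps A) t
  | .fvar _, _ | .bvar _, _ => by simp [Tm.Occ]
  | .fn n i ts, h => by
      simp only [Tm.EpsFree] at h
      rintro (h' | ⟨j, h'⟩)
      · cases h'
      · exact Tm.EpsFree.not_occ (h j) h'
  | .eps A, h => by simp [Tm.EpsFree] at h

theorem Fm.EpsFree.not_occ {A : Fm} : ∀ {B : Fm}, B.EpsFree → ¬ Fm.Occ (.eps A) B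
  | .pred n i ts, h => by
      simp only [Fm.EpsFree] at h
      rintro ⟨j, h'⟩
      exact Tm.EpsFree.not_occ (h j) h'
  | .eq t u, h => by
      simp only [Fm.EpsFree] at h
      exact fun h' => h'.elim (Tm.EpsFree.not_occ h.1) (Tm.EpsFree.not_occ h.2)
  | .bot, _ | .top, _ => by simp [Fm.Occ]
  | .neg B, h => Fm.EpsFree.not_occ (B := B) h
  | .and B C, h | .or B C, h | .imp B C, h | .iff B C, h => by
      simp only [Fm.EpsFree] at h
      exact fun h' => h'.elim (Fm.EpsFree.not_occ h.1) (Fm.EpsFree.not_occ h.2)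

end

mutual

/-- An occurrence in `a(e)` lies in an inserted `e`, or in `a` unchanged, or properly contains an
inserted `e`. -/
theorem Tm.Occ.of_inst {s e : Tm} (he : e.WF) :
    ∀ {a : Tm} {d : ℕ}, Tm.Occ s (Tm.inst e a d) →
      Tm.Occ s e ∨ Tm.Occ s a ∨ (Tm.Occ e s ∧ s.rank ≤ a.subRank d)
  | .fvar x, d, h => .inr (.inl h)
  | .bvar c, d, h => by
      simp only [Tm.inst] at h
      split_ifs at h
      · exact .inl h
      · exact .inr (.inl h)
  | .fn n i ts, d, h => by
      rcases h with h | ⟨j, h⟩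
      · by_cases hb : (Tm.fn n i ts).bcount d = 0
        · have := Tm.inst_of_bcount_eq_zero e hb
          simp only [Tm.inst] at this
          exact .inr (.inl (.inl (h.trans this)))
        · have := Tm.occ_inst e (Nat.pos_of_ne_zero hb)
          subst h
          exact .inr (.inr ⟨this, Nat.zero_le _⟩)
      · rcases Tm.Occ.of_inst he h with h | h | h
        · exact .inl h
        · exact .inr (.inl (.inr ⟨j, h⟩))
        · refine .inr (.inr ⟨h.1, h.2.trans ?_⟩)
          exact Finset.le_sup (f := fun j => (ts j).subRank d) (Finset.mem_univ j)
  | .eps A, d, h => by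
      rcases h with h | h
      · by_cases hb : (Tm.eps A).bcount d = 0
        · have := Tm.inst_of_bcount_eq_zero e hb
          simp only [Tm.inst] at this
          exact .inr (.inl (.inl (h.trans this)))
        · have := Tm.occ_inst e (Nat.pos_of_ne_zero hb)
          subst h
          refine .inr (.inr ⟨this, ?_⟩)
          simp only [Tm.bcount] at hb
          simp only [Tm.rank, Tm.subRank, Nat.pos_of_ne_zero hb, if_true]
          rw [Fm.subRank_inst he A (by omega)]
          exact le_max_left _ _
      · rcases Fm.Occ.of_inst he h with h | h | h
        · exact .inl h
        · exact .inr (.inl (.inr h))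
        · exact .inr (.inr ⟨h.1, h.2.trans (le_max_right _ _)⟩)

theorem Fm.Occ.of_inst {s e : Tm} (he : e.WF) :
    ∀ {A : Fm} {d : ℕ}, Fm.Occ s (Fm.inst e A d) →
      Tm.Occ s e ∨ Fm.Occ s A ∨ (Tm.Occ e s ∧ s.rank ≤ A.subRank d)
  | .pred n i ts, d, h => by
      obtain ⟨j, h⟩ := h
      rcases Tm.Occ.of_inst he h with h | h | h
      · exact .inl h
      · exact .inr (.inl ⟨j, h⟩)
      · refine .inr (.inr ⟨h.1, h.2.trans ?_⟩)
        exact Finset.le_sup (f := fun j => (ts j).subRank d) (Finset.mem_univ j)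
  | .eq t u, d, h => by
      rcases h with h | h
      · rcases Tm.Occ.of_inst he h with h | h | h
        exacts [.inl h, .inr (.inl (.inl h)), .inr (.inr ⟨h.1, h.2.trans (le_max_left _ _)⟩)]
      · rcases Tm.Occ.of_inst he h with h | h | h
        exacts [.inl h, .inr (.inl (.inr h)), .inr (.inr ⟨h.1, h.2.trans (le_max_right _ _)⟩)]
  | .bot, _, h | .top, _, h => by simp [Fm.inst, Fm.Occ] at h
  | .neg A, d, h => Fm.Occ.of_inst he (A := A) h
  | .and A B, d, h | .or A B, d, h | .imp A B, d, h | .iff A B, d, h => by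
      rcases h with h | h
      · rcases Fm.Occ.of_inst he h with h | h | h
        exacts [.inl h, .inr (.inl (.inl h)), .inr (.inr ⟨h.1, h.2.trans (le_max_left _ _)⟩)]
      · rcases Fm.Occ.of_inst he h with h | h | h
        exacts [.inl h, .inr (.inl (.inr h)), .inr (.inr ⟨h.1, h.2.trans (le_max_right _ _)⟩)]

end

theorem occ_body_of_occ_inst {A : Fm} {a s : Tm} (hA : (Tm.eps A).WF) (hs : s.WF)
    (hrank : a.subRank 0 ≤ A.subRank 0) (hw : a.weight ≤ A.weight)
    (hocc : Tm.Occ (Tm.inst s a 0) (Tm.inst (.eps A) a 0))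
    (hlt : (Tm.inst s a 0).weight < (Tm.inst (.eps A) a 0).weight) :
    Fm.Occ (Tm.inst s a 0) A ∧ a.weight < (Tm.inst s a 0).weight := by
  have hsp := hs.weight_pos
  rw [Tm.weight_inst, Tm.weight_inst] at hlt
  have hlt' := lt_of_add_lt_add_left hlt
  have hk : 0 < a.bcount 0 := by
    by_contra h
    have : a.bcount 0 = 0 := by omega
    simp [this] at hlt'
  have hse := lt_of_mul_lt_mul_left hlt' (Nat.zero_le _)
  have hgrow : a.weight < (Tm.inst s a 0).weight := by
    rw [Tm.weight_inst]
    have := Nat.mul_pos hk hsp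
    omega
  have hne : ¬ Tm.Occ (.eps A) (Tm.inst s a 0) := by
    intro h
    rcases h.of_inst hs with h | h | h
    · have := h.weight_le
      omega
    · have := h.weight_le
      simp only [Tm.weight] at this
      omega
    · have := h.2
      simp only [Tm.rank] at this
      omega
  refine ⟨?_, hgrow⟩
  rcases hocc.of_inst hA with (h | h) | h | h
  · exact absurd (h ▸ Tm.Occ.refl _) hne
  · exact h
  · have := h.weight_le
    omega
  · exact absurd h.1 hne

/-- An identity formula that replaces `t` by `u` below a function symbol or `ε` is not critical. -/
theorem not_isCrit_of_occ {t u a b e : Tm} (ht : Tm.Occ t a) (ht' : t.weight < a.weight)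
    (hu : Tm.Occ u b) (hu' : u.weight < b.weight) :
    ¬ IsCrit (.imp (.eq t u) (.eq a b)) e := by
  rintro ⟨A, s, rfl, hA, hs, h⟩
  cases A with
  | eq c d =>
    simp only [Fm.app, Fm.inst, Fm.imp.injEq, Fm.eq.injEq] at h
    obtain ⟨⟨rfl, rfl⟩, rfl, rfl⟩ := h
    have h1 := occ_body_of_occ_inst hA hs (le_max_left _ _)
      (by simp only [Fm.weight]; omega) ht ht'
    have h2 := occ_body_of_occ_inst hA hs (le_max_right _ _)
      (by simp only [Fm.weight]; omega) hu hu'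
    rcases h1 with ⟨h1 | h1, h1'⟩ <;> rcases h2 with ⟨h2 | h2, h2'⟩ <;>
      · have := h1.weight_le
        have := h2.weight_le
        omega
  | _ => simp [Fm.app, Fm.inst] at h

theorem IsEpsId.not_isCrit {F : Fm} {e' e : Tm} (h : IsEpsId F e' e) (c : Tm) : ¬ IsCrit F c := by
  obtain ⟨p, σ, x, t, u, ⟨-, ⟨P, rfl⟩, -, -⟩, hx, -, -, -, rfl, rfl, rfl⟩ := h
  have key : ∀ s : Tm, Fm.Occ s (P.subst (Function.update σ x s)) := fun s => by
    have := Fm.occ_subst (σ := Function.update σ x s) (A := P) (x := x)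
      (by simpa only [Tm.count] using hx)
    rwa [Function.update_self] at this
  have key' : ∀ s : Tm, s.weight < ((Tm.eps P).subst (Function.update σ x s)).weight := fun s => by
    have := (key s).weight_le
    simp only [Tm.subst, Tm.weight]
    omega
  exact not_isCrit_of_occ (.inr (key t)) (key' t) (.inr (key u)) (key' u)

theorem not_isCrit_fnId {n i : ℕ} {s : Fin n → Tm} {j : Fin n} {t u c : Tm} :
    ¬ IsCrit (.imp (.eq t u)
        (.eq (.fn n i (Function.update s j t)) (.fn n i (Function.update s j u)))) c := by
  have key : ∀ w : Tm, Tm.Occ w (.fn n i (Function.update s j w)) := fun w =>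
    .inr ⟨j, by rw [Function.update_self]; exact .refl w⟩
  have key' : ∀ w : Tm, w.weight < (Tm.fn n i (Function.update s j w)).weight := fun w => by
    have := Finset.single_le_sum (f := fun k => (Function.update s j w k).weight)
      (fun _ _ => Nat.zero_le _) (Finset.mem_univ j)
    simp only [Function.update_self] at this
    simp only [Tm.weight]
    omega
  exact not_isCrit_of_occ (key t) (key' t) (key u) (key' u)

theorem Tm.eq_of_inst_eq_of_occ_root {b f s : Tm} {d : ℕ} (hf : 0 < f.weight)
    (hb : ¬ Tm.Occ f b) (h : Tm.inst f b d = f) (h' : Tm.inst s b d = f) : s = f := by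
  have hw := congrArg Tm.weight h
  rw [Tm.weight_inst] at hw
  by_cases hk : b.bcount d = 0
  · rw [Tm.inst_of_bcount_eq_zero f hk] at h
    exact absurd (h ▸ Tm.Occ.refl _) hb
  · have hk1 : b.bcount d = 1 ∧ b.weight = 0 := by
      have h2 : b.bcount d * f.weight ≤ 1 * f.weight := by omega
      have h3 := Nat.le_of_mul_le_mul_right h2 hf
      have h4 : b.bcount d = 1 := by omega
      rw [h4] at hw
      omega
    cases b with
    | bvar c =>
      simp only [Tm.bcount] at hk
      split_ifs at hk with hc
      · simpa [Tm.inst, hc] using h'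
      · omega
    | _ => simp only [Tm.weight] at hk1; omega

theorem Tm.eq_of_inst_eq_bvar {a e f s t : Tm} {d : ℕ} (he : 0 < e.weight) (ha : Tm.Occ f a)
    (h : Tm.inst e a d = f) (h' : Tm.inst t a d = s) : s = f := by
  have hw := congrArg Tm.weight h
  rw [Tm.weight_inst] at hw
  have hle := ha.weight_le
  have hk : a.bcount d = 0 := by
    by_contra hk
    have := Nat.mul_pos (Nat.pos_of_ne_zero hk) he
    omega
  rw [← h, ← h', Tm.inst_of_bcount_eq_zero _ hk, Tm.inst_of_bcount_eq_zero _ hk]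

mutual

/-- If `a(e) = b(f)` and `a(t) = b(s)`, and `f` occurs in `a` but not in `b`, then `s = f`. -/
theorem Tm.eq_of_inst_eq_of_occ {e f s t : Tm} (he : e.WF) (hf : f.WF) :
    ∀ {a b : Tm} {d : ℕ}, Tm.Occ f a → ¬ Tm.Occ f b → Tm.inst e a d = Tm.inst f b d →
      Tm.inst t a d = Tm.inst s b d → s = f
  | a, .bvar c, d, ha, hb, h, h' => by
      by_cases hc : c = d
      · subst hc
        simp only [Tm.inst, if_true] at h h'
        exact Tm.eq_of_inst_eq_bvar he.weight_pos ha h h'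
      · cases a with
        | bvar c' =>
          simp only [Tm.Occ] at ha
          exact absurd (ha ▸ hf) (Tm.not_wf_bvar c')
        | _ => simp [Tm.inst, hc] at h
  | .fvar x, b, d, ha, hb, h, h' => by
      simp only [Tm.Occ] at ha
      subst ha
      exact Tm.eq_of_inst_eq_of_occ_root hf.weight_pos hb h.symm h'.symm
  | .bvar c', b, d, ha, hb, h, h' => by
      simp only [Tm.Occ] at ha
      exact absurd (ha ▸ hf) (Tm.not_wf_bvar c')
  | .fn n i ts, .fvar x, d, ha, hb, h, h' => by simp [Tm.inst] at h
  | .fn n i ts, .eps B, d, ha, hb, h, h' => by simp [Tm.inst] at h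
  | .eps A, .fvar x, d, ha, hb, h, h' => by simp [Tm.inst] at h
  | .eps A, .fn n i ts, d, ha, hb, h, h' => by simp [Tm.inst] at h
  | .fn n i ts, .fn m k us, d, ha, hb, h, h' => by
      rcases ha with ha | ⟨j, ha⟩
      · rw [← ha, Tm.inst_of_bcount_eq_zero _ (hf.bcount d)] at h h'
        exact Tm.eq_of_inst_eq_of_occ_root hf.weight_pos hb h.symm h'.symm
      · simp only [Tm.inst, Tm.fn.injEq] at h h'
        obtain ⟨rfl, rfl, h⟩ := h
        have h' := h'.2.2
        simp only [heq_eq_eq] at h h'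
        exact Tm.eq_of_inst_eq_of_occ he hf ha (fun hj => hb (.inr ⟨j, hj⟩)) (congrFun h j)
          (congrFun h' j)
  | .eps A, .eps B, d, ha, hb, h, h' => by
      rcases ha with ha | ha
      · rw [← ha, Tm.inst_of_bcount_eq_zero _ (hf.bcount d)] at h h'
        exact Tm.eq_of_inst_eq_of_occ_root hf.weight_pos hb h.symm h'.symm
      · simp only [Tm.inst, Tm.eps.injEq] at h h'
        exact Fm.eq_of_inst_eq_of_occ he hf ha (fun hj => hb (.inr hj)) h h'

/-- If `A(e) = B(f)` and `A(t) = B(s)`, and `f` occurs in `A` but not in `B`, then `s = f`. -/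
theorem Fm.eq_of_inst_eq_of_occ {e f s t : Tm} (he : e.WF) (hf : f.WF) :
    ∀ {A B : Fm} {d : ℕ}, Fm.Occ f A → ¬ Fm.Occ f B → Fm.inst e A d = Fm.inst f B d →
      Fm.inst t A d = Fm.inst s B d → s = f
  | .pred n i ts, B, d, ⟨j, ha⟩, hb, h, h' => by
      cases B with
      | pred m k us =>
        simp only [Fm.inst, Fm.pred.injEq] at h h'
        obtain ⟨rfl, rfl, h⟩ := h
        have h' := h'.2.2
        simp only [heq_eq_eq] at h h'
        exact Tm.eq_of_inst_eq_of_occ he hf ha (fun hj => hb ⟨j, hj⟩) (congrFun h j)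
          (congrFun h' j)
      | _ => simp [Fm.inst] at h
  | .eq t u, B, d, ha, hb, h, h' => by
      cases B with
      | eq t' u' =>
        simp only [Fm.inst, Fm.eq.injEq] at h h'
        simp only [Fm.Occ, not_or] at hb
        rcases ha with ha | ha
        · exact Tm.eq_of_inst_eq_of_occ he hf ha hb.1 h.1 h'.1
        · exact Tm.eq_of_inst_eq_of_occ he hf ha hb.2 h.2 h'.2
      | _ => simp [Fm.inst] at h
  | .bot, _, _, ha, _, _, _ | .top, _, _, ha, _, _, _ => by simp [Fm.Occ] at ha
  | .neg A, B, d, ha, hb, h, h' => by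
      cases B with
      | neg B =>
        simp only [Fm.inst, Fm.neg.injEq] at h h'
        exact Fm.eq_of_inst_eq_of_occ he hf (A := A) (B := B) ha hb h h'
      | _ => simp [Fm.inst] at h
  | .and A A', B, d, ha, hb, h, h' => by
      cases B with
      | and B B' =>
        simp only [Fm.inst, Fm.and.injEq] at h h'
        simp only [Fm.Occ, not_or] at hb
        rcases ha with ha | ha
        · exact Fm.eq_of_inst_eq_of_occ he hf ha hb.1 h.1 h'.1
        · exact Fm.eq_of_inst_eq_of_occ he hf ha hb.2 h.2 h'.2
      | _ => simp [Fm.inst] at h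
  | .or A A', B, d, ha, hb, h, h' => by
      cases B with
      | or B B' =>
        simp only [Fm.inst, Fm.or.injEq] at h h'
        simp only [Fm.Occ, not_or] at hb
        rcases ha with ha | ha
        · exact Fm.eq_of_inst_eq_of_occ he hf ha hb.1 h.1 h'.1
        · exact Fm.eq_of_inst_eq_of_occ he hf ha hb.2 h.2 h'.2
      | _ => simp [Fm.inst] at h
  | .imp A A', B, d, ha, hb, h, h' => by
      cases B with
      | imp B B' =>
        simp only [Fm.inst, Fm.imp.injEq] at h h'
        simp only [Fm.Occ, not_or] at hb
        rcases ha with ha | ha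
        · exact Fm.eq_of_inst_eq_of_occ he hf ha hb.1 h.1 h'.1
        · exact Fm.eq_of_inst_eq_of_occ he hf ha hb.2 h.2 h'.2
      | _ => simp [Fm.inst] at h
  | .iff A A', B, d, ha, hb, h, h' => by
      cases B with
      | iff B B' =>
        simp only [Fm.inst, Fm.iff.injEq] at h h'
        simp only [Fm.Occ, not_or] at hb
        rcases ha with ha | ha
        · exact Fm.eq_of_inst_eq_of_occ he hf ha hb.1 h.1 h'.1
        · exact Fm.eq_of_inst_eq_of_occ he hf ha hb.2 h.2 h'.2
      | _ => simp [Fm.inst] at h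

end

/-- The rank of the `ε`-term of a critical formula is determined by the formula, unless this is of
the form `G → G`. -/
theorem IsCrit.rank_le {G H : Fm} {e f : Tm} (he : IsCrit (.imp G H) e) (hf : IsCrit (.imp G H) f)
    (hne : G ≠ H) : f.rank ≤ e.rank := by
  obtain ⟨A, t, rfl, heA, -, h⟩ := he
  obtain ⟨B, s, rfl, heB, -, h'⟩ := hf
  simp only [Fm.imp.injEq] at h h'
  obtain ⟨rfl, rfl⟩ := h
  by_contra hlt
  push Not at hlt
  have hA : Fm.Occ (.eps B) A := by
    have hocc : Fm.Occ (.eps B) (A.app (.eps A)) := by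
      rw [h'.2]
      exact Fm.occ_inst _ heB.2
    rcases hocc.of_inst heA with (h | h) | h | h
    · rw [h] at hlt
      exact absurd hlt (lt_irrefl _)
    · exact h
    · exact h
    · have := h.2
      simp only [Tm.rank] at this hlt
      omega
  have hB : ¬ Fm.Occ (.eps B) B := fun h => by
    have := h.weight_le
    simp only [Tm.weight] at this
    omega
  refine hne ?_
  rw [h'.1, h'.2, Fm.eq_of_inst_eq_of_occ heA heB hA hB h'.2 h'.1]

/-! ### Valuations satisfying the restricted axioms -/

/-- The nonpropositional axioms, with `ε`-identity formulas of rank `< r` and critical formulas of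
rank `≤ r` only. -/
inductive RestrictedAxiom (r : ℕ) : Fm → Prop where
  | refl (t : Tm) : RestrictedAxiom r (.eq t t)
  | predId (n i : ℕ) (s : Fin n → Tm) (j : Fin n) (t u : Tm) :
      RestrictedAxiom r (.imp (.eq t u)
        (.imp (.pred n i (Function.update s j t)) (.pred n i (Function.update s j u))))
  | eqIdLeft (t u s : Tm) : RestrictedAxiom r (.imp (.eq t u) (.imp (.eq t s) (.eq u s)))
  | eqIdRight (t u s : Tm) : RestrictedAxiom r (.imp (.eq t u) (.imp (.eq s t) (.eq s u)))
  | fnId (n i : ℕ) (s : Fin n → Tm) (j : Fin n) (t u : Tm) :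
      RestrictedAxiom r (.imp (.eq t u)
        (.eq (.fn n i (Function.update s j t)) (.fn n i (Function.update s j u))))
  | epsId (F : Fm) (e' e : Tm) : IsEpsId F e' e → e.rank < r → RestrictedAxiom r F
  | crit (F : Fm) (e : Tm) : IsCrit F e → (∀ e', IsCrit F e' → e'.rank ≤ r) →
      RestrictedAxiom r F

/-- The valuation `v` satisfies all restricted axioms. -/
def IsModel (r : ℕ) (v : Fm → Prop) : Prop := ∀ F : Fm, F.WF → RestrictedAxiom r F → F.val v

theorem ite_mem_of_update {ι α : Type*} [DecidableEq ι] (Q : (ι → α) → Prop) (f g : ι → α)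
    (step : ∀ (h : ι → α) (j : ι), (∀ i, h i = f i ∨ h i = g i) → h j = f j → Q h →
      Q (Function.update h j (g j))) (hf : Q f) (s : Finset ι) :
    Q fun i => if i ∈ s then g i else f i := by
  induction s using Finset.induction_on with
  | empty => simpa using hf
  | insert a s ha ih =>
    have := step _ a (fun i => by by_cases hi : i ∈ s <;> simp [hi]) (by simp [ha]) ih
    convert this using 1
    funext i
    by_cases hi : i = a
    · subst hi; simp
    · simp [hi]

namespace IsModel

variable {r : ℕ} {v : Fm → Prop}

theorem val_of_restricted (M : IsModel r v) {F : Fm} (h : RestrictedAxiom r F) (hw : F.WF) :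
    F.val v :=
  M F hw h

theorem refl (M : IsModel r v) {t : Tm} (ht : t.WF) : v (.eq t t) :=
  M.val_of_restricted (.refl t) ⟨ht, ht⟩

theorem symm (M : IsModel r v) {t u : Tm} (ht : t.WF) (hu : u.WF) (h : v (.eq t u)) :
    v (.eq u t) :=
  M.val_of_restricted (.eqIdLeft t u t) ⟨⟨ht, hu⟩, ⟨ht, ht⟩, ⟨hu, ht⟩⟩ h (M.refl ht)

theorem trans (M : IsModel r v) {s t u : Tm} (hs : s.WF) (ht : t.WF) (hu : u.WF)
    (h : v (.eq s t)) (h' : v (.eq t u)) : v (.eq s u) :=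
  M.val_of_restricted (.eqIdRight t u s) ⟨⟨ht, hu⟩, ⟨hs, ht⟩, ⟨hs, hu⟩⟩ h' h

theorem eq_iff (M : IsModel r v) {t t' u u' : Tm} (ht : t.WF) (ht' : t'.WF) (hu : u.WF)
    (hu' : u'.WF) (h : v (.eq t t')) (h' : v (.eq u u')) : v (.eq t u) ↔ v (.eq t' u') :=
  ⟨fun e => M.trans ht' ht hu' (M.symm ht ht' h) (M.trans ht hu hu' e h'),
    fun e => M.trans ht ht' hu h (M.trans ht' hu' hu e (M.symm hu hu' h'))⟩

theorem fn_congr (M : IsModel r v) {n i : ℕ} {ts us : Fin n → Tm} (ht : ∀ j, (ts j).WF)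
    (hu : ∀ j, (us j).WF) (h : ∀ j, v (.eq (ts j) (us j))) :
    v (.eq (.fn n i ts) (.fn n i us)) := by
  have := ite_mem_of_update (fun g => v (.eq (.fn n i ts) (.fn n i g))) ts us ?_
    (M.refl (Tm.wf_fn.2 ht)) Finset.univ
  · simpa using this
  · intro g j hg hj hQ
    have hgw : ∀ k, (g k).WF := fun k => by
      rcases hg k with e | e <;> rw [e]
      exacts [ht k, hu k]
    have hw : (Tm.fn n i (Function.update g j (us j))).WF := Tm.wf_fn.2 fun k => by
      by_cases hk : k = j
      · subst hk; simpa using hu k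
      · simpa [hk] using hgw k
    have hself : Function.update g j (ts j) = g := by rw [← hj, Function.update_eq_self]
    have ax := RestrictedAxiom.fnId (r := r) n i g j (ts j) (us j)
    rw [hself] at ax
    exact M.trans (Tm.wf_fn.2 ht) (Tm.wf_fn.2 hgw) hw hQ
      (M.val_of_restricted ax ⟨⟨ht j, hu j⟩, Tm.wf_fn.2 hgw, hw⟩ (h j))

theorem pred_congr (M : IsModel r v) {n i : ℕ} {ts us : Fin n → Tm} (ht : ∀ j, (ts j).WF)
    (hu : ∀ j, (us j).WF) (h : ∀ j, v (.eq (ts j) (us j))) (hp : v (.pred n i ts)) :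
    v (.pred n i us) := by
  have := ite_mem_of_update (fun g => v (.pred n i g)) ts us ?_ hp Finset.univ
  · simpa using this
  · intro g j hg hj hQ
    have hgw : ∀ k, (g k).WF := fun k => by
      rcases hg k with e | e <;> rw [e]
      exacts [ht k, hu k]
    have hw : (Fm.pred n i (Function.update g j (us j))).WF := fun k => by
      by_cases hk : k = j
      · subst hk; rw [Function.update_self]; exact hu k
      · rw [Function.update_of_ne hk]; exact hgw k
    have hself : Function.update g j (ts j) = g := by rw [← hj, Function.update_eq_self]
    have ax := RestrictedAxiom.predId (r := r) n i g j (ts j) (us j)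
    rw [hself] at ax
    exact M.val_of_restricted ax ⟨⟨ht j, hu j⟩, hgw, hw⟩ (h j) hQ

theorem eps_congr (M : IsModel r v) {P : Fm} {σ τ : ℕ → Tm} (hw : (Tm.eps P).WF) (hP : P.Skel)
    (hlin : ∀ x, P.count x ≤ 1) (hr : (Tm.eps P).rank < r) (hσ : ∀ y, (σ y).WF)
    (hτ : ∀ y, (τ y).WF) (h : ∀ y, v (.eq (σ y) (τ y))) :
    v (.eq ((Tm.eps P).subst σ) ((Tm.eps P).subst τ)) := by
  obtain ⟨N, hN⟩ := (Tm.eps P).exists_count_eq_zero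
  have := ite_mem_of_update (fun g => v (.eq ((Tm.eps P).subst σ) ((Tm.eps P).subst g))) σ τ ?_
    (M.refl ((Tm.wf_subst hσ _).2 hw)) (Finset.range N)
  · rwa [Tm.subst_congr (σ := fun y => if y ∈ Finset.range N then τ y else σ y) (τ := τ) _
      fun y hy => ?_] at this
    have : y < N := by
      by_contra hy'
      have := hN y (by omega)
      omega
    simp [this]
  · intro g y hg hy hQ
    have hgw : ∀ k, (g k).WF := fun k => by
      rcases hg k with e | e <;> rw [e]
      exacts [hσ k, hτ k]
    have hw' : ∀ k, (Function.update g y (τ y) k).WF := fun k => by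
      by_cases hk : k = y
      · subst hk; simpa using hτ k
      · simpa [hk] using hgw k
    have hself : Function.update g y (σ y) = g := by rw [← hy, Function.update_eq_self]
    by_cases hc : 0 < (Tm.eps P).count y
    · refine M.trans ((Tm.wf_subst hσ _).2 hw) ((Tm.wf_subst hgw _).2 hw)
        ((Tm.wf_subst hw' _).2 hw) hQ ?_
      refine M (.imp (.eq (σ y) (τ y)) (.eq ((Tm.eps P).subst g)
        ((Tm.eps P).subst (Function.update g y (τ y)))))
        ⟨⟨hσ y, hτ y⟩, (Tm.wf_subst hgw _).2 hw, (Tm.wf_subst hw' _).2 hw⟩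
        (.epsId _ ((Tm.eps P).subst g) ((Tm.eps P).subst (Function.update g y (τ y)))
          ⟨.eps P, g, y, σ y, τ y, isEpsType_of_skel hw hP hlin, hc, hgw, hσ y, hτ y, ?_, rfl, rfl⟩
          ?_) (h y)
      · rw [hself]
      · rwa [Tm.rank_subst_eps hw']
    · rwa [Tm.subst_congr (σ := Function.update g y (τ y)) (τ := g) _ fun z hz => ?_]
      rw [Function.update_of_ne]
      rintro rfl
      exact hc hz

end IsModel

/-! ### Replacement of equal terms below `ε`-terms of rank `< r` -/

mutual

/-- `t` and `u` differ by replacing terms that are equal under `v`, where the `ε`-terms that are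
changed inside have rank `< r`. -/
inductive TmSim (r : ℕ) (v : Fm → Prop) : Tm → Tm → Prop where
  | closed {t u : Tm} : t.WF → u.WF → v (.eq t u) → TmSim r v t u
  | bvar (d : ℕ) : TmSim r v (.bvar d) (.bvar d)
  | fn (n i : ℕ) {ts us : Fin n → Tm} : (∀ j, TmSim r v (ts j) (us j)) →
      TmSim r v (.fn n i ts) (.fn n i us)
  | eps {A B : Fm} : FmSim r v A B → (1 + A.subRank 0 < r ∨ A = B) →
      TmSim r v (.eps A) (.eps B)

/-- `A` and `B` differ by replacing terms that are equal under `v`, where the `ε`-terms that are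
changed inside have rank `< r`. -/
inductive FmSim (r : ℕ) (v : Fm → Prop) : Fm → Fm → Prop where
  | pred (n i : ℕ) {ts us : Fin n → Tm} : (∀ j, TmSim r v (ts j) (us j)) →
      FmSim r v (.pred n i ts) (.pred n i us)
  | eq {t t' u u' : Tm} : TmSim r v t t' → TmSim r v u u' → FmSim r v (.eq t u) (.eq t' u')
  | bot : FmSim r v .bot .bot
  | top : FmSim r v .top .top
  | neg {A A' : Fm} : FmSim r v A A' → FmSim r v (.neg A) (.neg A')
  | and {A A' B B' : Fm} : FmSim r v A A' → FmSim r v B B' → FmSim r v (.and A B) (.and A' B')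
  | or {A A' B B' : Fm} : FmSim r v A A' → FmSim r v B B' → FmSim r v (.or A B) (.or A' B')
  | imp {A A' B B' : Fm} : FmSim r v A A' → FmSim r v B B' → FmSim r v (.imp A B) (.imp A' B')
  | iff {A A' B B' : Fm} : FmSim r v A A' → FmSim r v B B' → FmSim r v (.iff A B) (.iff A' B')

end

mutual

theorem TmSim.refl {r : ℕ} {v : Fm → Prop} (M : IsModel r v) : ∀ t : Tm, TmSim r v t t
  | .fvar x => .closed (Tm.wf_fvar x) (Tm.wf_fvar x) (M.refl (Tm.wf_fvar x))
  | .bvar d => .bvar d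
  | .fn n i ts => .fn n i fun j => TmSim.refl M (ts j)
  | .eps A => .eps (FmSim.refl M A) (.inr rfl)

theorem FmSim.refl {r : ℕ} {v : Fm → Prop} (M : IsModel r v) : ∀ A : Fm, FmSim r v A A
  | .pred n i ts => .pred n i fun j => TmSim.refl M (ts j)
  | .eq t u => .eq (TmSim.refl M t) (TmSim.refl M u)
  | .bot => .bot
  | .top => .top
  | .neg A => .neg (FmSim.refl M A)
  | .and A B => .and (FmSim.refl M A) (FmSim.refl M B)
  | .or A B => .or (FmSim.refl M A) (FmSim.refl M B)
  | .imp A B => .imp (FmSim.refl M A) (FmSim.refl M B)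
  | .iff A B => .iff (FmSim.refl M A) (FmSim.refl M B)

end

mutual

theorem TmSim.bcount_eq {r : ℕ} {v : Fm → Prop} :
    ∀ {t u : Tm}, TmSim r v t u → ∀ d, t.bcount d = u.bcount d
  | _, _, .closed ht hu _, d => by rw [ht.bcount, hu.bcount]
  | _, _, .bvar _, _ => rfl
  | _, _, .fn _ _ h, d => by
      simp only [Tm.bcount]
      exact Finset.sum_congr rfl fun j _ => TmSim.bcount_eq (h j) d
  | _, _, .eps h _, d => by
      simp only [Tm.bcount]
      exact FmSim.bcount_eq h (d + 1)

theorem FmSim.bcount_eq {r : ℕ} {v : Fm → Prop} :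
    ∀ {A B : Fm}, FmSim r v A B → ∀ d, A.bcount d = B.bcount d
  | _, _, .pred _ _ h, d => by
      simp only [Fm.bcount]
      exact Finset.sum_congr rfl fun j _ => TmSim.bcount_eq (h j) d
  | _, _, .eq h h', d => by
      simp only [Fm.bcount, TmSim.bcount_eq h d, TmSim.bcount_eq h' d]
  | _, _, .bot, _ | _, _, .top, _ => rfl
  | _, _, .neg h, d => by simp only [Fm.bcount, FmSim.bcount_eq h d]
  | _, _, .and h h', d | _, _, .or h h', d | _, _, .imp h h', d | _, _, .iff h h', d => by
      simp only [Fm.bcount, FmSim.bcount_eq h d, FmSim.bcount_eq h' d]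

end

mutual

theorem TmSim.wfAt_iff {r : ℕ} {v : Fm → Prop} :
    ∀ {t u : Tm}, TmSim r v t u → ∀ d, t.WFAt d ↔ u.WFAt d
  | _, _, .closed ht hu _, d => iff_of_true (ht.wfAt d) (hu.wfAt d)
  | _, _, .bvar _, _ => Iff.rfl
  | _, _, .fn _ _ h, d => by
      simp only [Tm.WFAt]
      exact forall_congr' fun j => TmSim.wfAt_iff (h j) d
  | _, _, .eps h _, d => by
      simp only [Tm.WFAt]
      rw [FmSim.wfAt_iff h (d + 1), FmSim.bcount_eq h 0]

theorem FmSim.wfAt_iff {r : ℕ} {v : Fm → Prop} :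
    ∀ {A B : Fm}, FmSim r v A B → ∀ d, A.WFAt d ↔ B.WFAt d
  | _, _, .pred _ _ h, d => by
      simp only [Fm.WFAt]
      exact forall_congr' fun j => TmSim.wfAt_iff (h j) d
  | _, _, .eq h h', d => by
      simp only [Fm.WFAt, TmSim.wfAt_iff h d, TmSim.wfAt_iff h' d]
  | _, _, .bot, _ | _, _, .top, _ => Iff.rfl
  | _, _, .neg h, d => by simp only [Fm.WFAt, FmSim.wfAt_iff h d]
  | _, _, .and h h', d | _, _, .or h h', d | _, _, .imp h h', d | _, _, .iff h h', d => by
      simp only [Fm.WFAt, FmSim.wfAt_iff h d, FmSim.wfAt_iff h' d]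

end

/-- `σ` and `τ` are pointwise equal under `v`. -/
def SubstEqv (v : Fm → Prop) (σ τ : ℕ → Tm) : Prop :=
  ∀ y, (σ y).WF ∧ (τ y).WF ∧ v (.eq (σ y) (τ y))

/-- `t` and `u` are substitution instances, under pointwise equal substitutions, of the same linear
skeleton. -/
def Tm.CommonSkel (v : Fm → Prop) (t u : Tm) : Prop :=
  ∃ (p : Tm) (σ τ : ℕ → Tm), p.Skel ∧ (∀ x, p.count x ≤ 1) ∧ SubstEqv v σ τ ∧
    t = p.subst σ ∧ u = p.subst τ

/-- `A` and `B` are substitution instances, under pointwise equal substitutions, of the same linear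
skeleton. -/
def Fm.CommonSkel (v : Fm → Prop) (A B : Fm) : Prop :=
  ∃ (P : Fm) (σ τ : ℕ → Tm), P.Skel ∧ (∀ x, P.count x ≤ 1) ∧ SubstEqv v σ τ ∧
    A = P.subst σ ∧ B = P.subst τ

theorem Tm.CommonSkel.of_eq {v : Fm → Prop} {t u : Tm} (ht : t.WF) (hu : u.WF)
    (h : v (.eq t u)) : Tm.CommonSkel v t u :=
  ⟨.fvar 0, fun _ => t, fun _ => u, by simp [Tm.Skel],
    fun x => by simp only [Tm.count]; split_ifs <;> omega, fun _ => ⟨ht, hu, h⟩,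
    by simp [Tm.subst], by simp [Tm.subst]⟩

/-- Finitely many common skeletons can be given disjoint variables. -/
theorem Tm.CommonSkel.pi {v : Fm → Prop} (h0 : v (.eq (.fvar 0) (.fvar 0))) {n : ℕ}
    {ts us : Fin n → Tm} (h : ∀ j, Tm.CommonSkel v (ts j) (us j)) :
    ∃ (p : Fin n → Tm) (σ τ : ℕ → Tm), (∀ j, (p j).Skel) ∧ (∀ x, ∑ j, (p j).count x ≤ 1) ∧
      SubstEqv v σ τ ∧ (∀ j, ts j = (p j).subst σ) ∧ ∀ j, us j = (p j).subst τ := by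
  choose p σ τ hp hlin hστ ht hu using h
  have hinj : ∀ j : Fin n, Function.Injective fun y => Nat.pair j y := fun j a b hab =>
    (Nat.pair_eq_pair.1 hab).2
  refine ⟨fun j => (p j).subst fun y => .fvar (Nat.pair j y),
    fun z => if hz : z.unpair.1 < n then σ ⟨_, hz⟩ z.unpair.2 else .fvar 0,
    fun z => if hz : z.unpair.1 < n then τ ⟨_, hz⟩ z.unpair.2 else .fvar 0,
    fun j => (hp j).rename _, fun x => ?_, fun z => ?_, fun j => ?_, fun j => ?_⟩
  · have hzero : ∀ j : Fin n, (j : ℕ) ≠ x.unpair.1 →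
        ((p j).subst fun y => .fvar (Nat.pair j y)).count x = 0 := fun j hj =>
      Tm.count_rename_of_notMem (fun y hy => hj (by rw [← hy, Nat.unpair_pair])) _
    by_cases hx : x.unpair.1 < n
    · rw [Finset.sum_eq_single ⟨_, hx⟩ (fun j _ hj => hzero j fun e => hj (Fin.ext e)) (by simp)]
      have := Tm.count_rename (hinj ⟨_, hx⟩) x.unpair.2 (p ⟨_, hx⟩)
      simp only [Nat.pair_unpair] at this
      exact this.trans_le (hlin _ _)
    · rw [Finset.sum_eq_zero fun j _ => hzero j (by omega)]
      exact Nat.zero_le _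
  · dsimp only
    split_ifs with hz
    · exact hστ _ _
    · exact ⟨Tm.wf_fvar 0, Tm.wf_fvar 0, h0⟩
  · rw [Tm.subst_subst, ht j]
    congr 1
    funext y
    simp [Tm.subst]
  · rw [Tm.subst_subst, hu j]
    congr 1
    funext y
    simp [Tm.subst]

/-- Two common skeletons can be given disjoint variables. -/
theorem Fm.CommonSkel.pair {v : Fm → Prop} {A A' B B' : Fm}
    (hA : Fm.CommonSkel v A A') (hB : Fm.CommonSkel v B B') :
    ∃ (P Q : Fm) (σ τ : ℕ → Tm), P.Skel ∧ Q.Skel ∧ (∀ x, P.count x + Q.count x ≤ 1) ∧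
      SubstEqv v σ τ ∧ (A = P.subst σ ∧ A' = P.subst τ) ∧ B = Q.subst σ ∧ B' = Q.subst τ := by
  obtain ⟨P, σ, τ, hP, hPl, hστ, rfl, rfl⟩ := hA
  obtain ⟨Q, σ', τ', hQ, hQl, hστ', rfl, rfl⟩ := hB
  have h0 : Function.Injective fun y : ℕ => 2 * y := fun a b hab => by simpa using hab
  have h1 : Function.Injective fun y : ℕ => 2 * y + 1 := fun a b hab => by simpa using hab
  refine ⟨P.subst fun y => .fvar (2 * y), Q.subst fun y => .fvar (2 * y + 1),
    fun z => if z % 2 = 0 then σ (z / 2) else σ' (z / 2),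
    fun z => if z % 2 = 0 then τ (z / 2) else τ' (z / 2),
    hP.rename _, hQ.rename _, fun x => ?_, fun z => ?_, ⟨?_, ?_⟩, ?_, ?_⟩
  · rcases Nat.even_or_odd' x with ⟨y, rfl | rfl⟩
    · rw [Fm.count_rename h0, Fm.count_rename_of_notMem (fun z => by omega)]
      exact hPl y
    · rw [Fm.count_rename h1, Fm.count_rename_of_notMem (fun z => by omega), zero_add]
      exact hQl y
  · dsimp only
    split_ifs
    exacts [hστ _, hστ' _]
  all_goals
    rw [Fm.subst_subst]
    congr 1
    funext y
    simp [Tm.subst, Nat.mul_add_div]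

theorem Tm.CommonSkel.fn {v : Fm → Prop} (h0 : v (.eq (.fvar 0) (.fvar 0))) {n : ℕ} (i : ℕ)
    {ts us : Fin n → Tm} (h : ∀ j, Tm.CommonSkel v (ts j) (us j))
    (hw : ¬ (Tm.fn n i ts).WF) : Tm.CommonSkel v (.fn n i ts) (.fn n i us) := by
  obtain ⟨p, σ, τ, hp, hlin, hστ, ht, hu⟩ := Tm.CommonSkel.pi h0 h
  have ht' : Tm.fn n i ts = (Tm.fn n i p).subst σ := by
    simp only [Tm.subst]; congr 1; funext j; exact ht j
  refine ⟨.fn n i p, σ, τ, ?_, fun x => by simpa only [Tm.count] using hlin x, hστ, ht', ?_⟩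
  · simp only [Tm.Skel]
    refine ⟨fun hw' => hw ?_, hp⟩
    rw [ht']
    exact (Tm.wf_subst (fun y => (hστ y).1) _).2 hw'
  · simp only [Tm.subst]; congr 1; funext j; exact hu j

theorem Fm.CommonSkel.pred {v : Fm → Prop} (h0 : v (.eq (.fvar 0) (.fvar 0))) {n : ℕ} (i : ℕ)
    {ts us : Fin n → Tm} (h : ∀ j, Tm.CommonSkel v (ts j) (us j)) :
    Fm.CommonSkel v (.pred n i ts) (.pred n i us) := by
  obtain ⟨p, σ, τ, hp, hlin, hστ, ht, hu⟩ := Tm.CommonSkel.pi h0 h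
  refine ⟨.pred n i p, σ, τ, by simpa only [Fm.Skel] using hp,
    fun x => by simpa only [Fm.count] using hlin x, hστ, ?_, ?_⟩
  · simp only [Fm.subst]; congr 1; funext j; exact ht j
  · simp only [Fm.subst]; congr 1; funext j; exact hu j

theorem Fm.CommonSkel.eq {v : Fm → Prop} (h0 : v (.eq (.fvar 0) (.fvar 0))) {t t' u u' : Tm}
    (h : Tm.CommonSkel v t t') (h' : Tm.CommonSkel v u u') :
    Fm.CommonSkel v (.eq t u) (.eq t' u') := by
  obtain ⟨p, σ, τ, hp, hlin, hστ, ht, hu⟩ :=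
    Tm.CommonSkel.pi h0 (ts := ![t, u]) (us := ![t', u']) fun j => by
      fin_cases j
      exacts [h, h']
  refine ⟨.eq (p 0) (p 1), σ, τ, by simp [Fm.Skel, hp], fun x => ?_, hστ, ?_, ?_⟩
  · simpa [Fm.count, Fin.sum_univ_two] using hlin x
  · simp only [Fm.subst, ← ht]; rfl
  · simp only [Fm.subst, ← hu]; rfl

mutual

theorem TmSim.main {r : ℕ} {v : Fm → Prop} (M : IsModel r v) :
    ∀ {t u : Tm}, TmSim r v t u → Tm.CommonSkel v t u ∧ (t.WF → v (.eq t u))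
  | _, _, .closed ht hu h => ⟨.of_eq ht hu h, fun _ => h⟩
  | _, _, .bvar d =>
      ⟨⟨.bvar d, .fvar, .fvar, by simp [Tm.Skel], by simp [Tm.count],
        fun y => ⟨Tm.wf_fvar y, Tm.wf_fvar y, M.refl (Tm.wf_fvar y)⟩, by simp [Tm.subst],
        by simp [Tm.subst]⟩, fun h => absurd h (Tm.not_wf_bvar d)⟩
  | _, _, @TmSim.fn _ _ n i ts us h => by
      by_cases hw : (Tm.fn n i ts).WF
      · have hw' : (Tm.fn n i us).WF := (TmSim.wfAt_iff (.fn n i h) 0).1 hw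
        have key : v (.eq (.fn n i ts) (.fn n i us)) :=
          M.fn_congr (Tm.wf_fn.1 hw) (Tm.wf_fn.1 hw')
            fun j => (TmSim.main M (h j)).2 (Tm.wf_fn.1 hw j)
        exact ⟨.of_eq hw hw' key, fun _ => key⟩
      · exact ⟨Tm.CommonSkel.fn (M.refl (Tm.wf_fvar 0)) i (fun j => (TmSim.main M (h j)).1) hw,
          fun h => absurd h hw⟩
  | _, _, @TmSim.eps _ _ A B h hr => by
      obtain ⟨P, σ, τ, hP, hlin, hστ, hA, hB⟩ := (FmSim.main M h).1
      have hA' : Tm.eps A = (Tm.eps P).subst σ := by simp only [Tm.subst, ← hA]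
      have hB' : Tm.eps B = (Tm.eps P).subst τ := by simp only [Tm.subst, ← hB]
      by_cases hw : (Tm.eps A).WF
      · have hw' : (Tm.eps B).WF := (TmSim.wfAt_iff (.eps h hr) 0).1 hw
        have key : v (.eq (.eps A) (.eps B)) := by
          rcases hr with hr | rfl
          · have hr' : (Tm.eps P).rank < r := by
              rw [← Tm.rank_subst_eps (fun y => (hστ y).1), ← hA']
              exact hr
            rw [hA', hB']
            rw [hA'] at hw
            exact M.eps_congr ((Tm.wf_subst (fun y => (hστ y).1) _).1 hw) hP hlin hr'
              (fun y => (hστ y).1) (fun y => (hστ y).2.1) fun y => (hστ y).2.2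
          · exact M.refl hw
        exact ⟨.of_eq hw hw' key, fun _ => key⟩
      · refine ⟨⟨.eps P, σ, τ, ?_, fun x => by simpa only [Tm.count] using hlin x, hστ, hA', hB'⟩,
          fun h => absurd h hw⟩
        simp only [Tm.Skel]
        refine ⟨fun hw' => hw ?_, hP⟩
        rw [hA']
        exact (Tm.wf_subst (fun y => (hστ y).1) _).2 hw'

theorem FmSim.main {r : ℕ} {v : Fm → Prop} (M : IsModel r v) :
    ∀ {A B : Fm}, FmSim r v A B → Fm.CommonSkel v A B ∧ (A.WF → (A.val v ↔ B.val v))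
  | _, _, @FmSim.pred _ _ n i ts us h => by
      refine ⟨.pred (M.refl (Tm.wf_fvar 0)) i fun j => (TmSim.main M (h j)).1, fun hw => ?_⟩
      have hw' : (Fm.pred n i us).WF := (FmSim.wfAt_iff (.pred n i h) 0).1 hw
      have key := fun j => (TmSim.main M (h j)).2 (hw j)
      exact ⟨M.pred_congr hw hw' key,
        M.pred_congr hw' hw fun j => M.symm (hw j) (hw' j) (key j)⟩
  | _, _, .eq h h' => by
      refine ⟨.eq (M.refl (Tm.wf_fvar 0)) (TmSim.main M h).1 (TmSim.main M h').1, fun hw => ?_⟩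
      have hw' := (FmSim.wfAt_iff (.eq h h') 0).1 hw
      exact M.eq_iff hw.1 hw'.1 hw.2 hw'.2 ((TmSim.main M h).2 hw.1) ((TmSim.main M h').2 hw.2)
  | _, _, .bot =>
      ⟨⟨.bot, .fvar, .fvar, by simp [Fm.Skel], by simp [Fm.count],
        fun y => ⟨Tm.wf_fvar y, Tm.wf_fvar y, M.refl (Tm.wf_fvar y)⟩, by simp [Fm.subst],
        by simp [Fm.subst]⟩, fun _ => Iff.rfl⟩
  | _, _, .top =>
      ⟨⟨.top, .fvar, .fvar, by simp [Fm.Skel], by simp [Fm.count],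
        fun y => ⟨Tm.wf_fvar y, Tm.wf_fvar y, M.refl (Tm.wf_fvar y)⟩, by simp [Fm.subst],
        by simp [Fm.subst]⟩, fun _ => Iff.rfl⟩
  | _, _, .neg h => by
      obtain ⟨⟨P, σ, τ, hP, hlin, hστ, rfl, rfl⟩, hv⟩ := FmSim.main M h
      exact ⟨⟨.neg P, σ, τ, hP, hlin, hστ, rfl, rfl⟩, fun hw => not_congr (hv hw)⟩
  | _, _, .and h h' => by
      obtain ⟨hs, hv⟩ := FmSim.main M h
      obtain ⟨hs', hv'⟩ := FmSim.main M h'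
      refine ⟨?_, fun hw => and_congr (hv hw.1) (hv' hw.2)⟩
      obtain ⟨P, Q, σ, τ, hP, hQ, hlin, hστ, ⟨rfl, rfl⟩, rfl, rfl⟩ := hs.pair hs'
      exact ⟨.and P Q, σ, τ, ⟨hP, hQ⟩, hlin, hστ, rfl, rfl⟩
  | _, _, .or h h' => by
      obtain ⟨hs, hv⟩ := FmSim.main M h
      obtain ⟨hs', hv'⟩ := FmSim.main M h'
      refine ⟨?_, fun hw => or_congr (hv hw.1) (hv' hw.2)⟩
      obtain ⟨P, Q, σ, τ, hP, hQ, hlin, hστ, ⟨rfl, rfl⟩, rfl, rfl⟩ := hs.pair hs'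
      exact ⟨.or P Q, σ, τ, ⟨hP, hQ⟩, hlin, hστ, rfl, rfl⟩
  | _, _, .imp h h' => by
      obtain ⟨hs, hv⟩ := FmSim.main M h
      obtain ⟨hs', hv'⟩ := FmSim.main M h'
      refine ⟨?_, fun hw => imp_congr (hv hw.1) (hv' hw.2)⟩
      obtain ⟨P, Q, σ, τ, hP, hQ, hlin, hστ, ⟨rfl, rfl⟩, rfl, rfl⟩ := hs.pair hs'
      exact ⟨.imp P Q, σ, τ, ⟨hP, hQ⟩, hlin, hστ, rfl, rfl⟩
  | _, _, .iff h h' => by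
      obtain ⟨hs, hv⟩ := FmSim.main M h
      obtain ⟨hs', hv'⟩ := FmSim.main M h'
      refine ⟨?_, fun hw => iff_congr (hv hw.1) (hv' hw.2)⟩
      obtain ⟨P, Q, σ, τ, hP, hQ, hlin, hστ, ⟨rfl, rfl⟩, rfl, rfl⟩ := hs.pair hs'
      exact ⟨.iff P Q, σ, τ, ⟨hP, hQ⟩, hlin, hστ, rfl, rfl⟩

end

/-! ### The valuation obtained by evaluating `ε`-terms at representatives -/

instance : Nonempty Tm := ⟨.fvar 0⟩

/-- A representative of the class of `t` with respect to equality under `v`. -/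
noncomputable def Tm.rep (v : Fm → Prop) (t : Tm) : Tm :=
  Classical.epsilon fun u : Tm => u.WF ∧ v (.eq t u)

open scoped Classical in
/-- The representative of `s` if `p` holds, and `s` otherwise. -/
noncomputable def Tm.repIf (v : Fm → Prop) (p : Prop) (s : Tm) : Tm := if p then s.rep v else s

mutual

/-- Replace every closed subterm, from the inside outwards, by a representative. -/
noncomputable def Tm.tr (v : Fm → Prop) : Tm → Tm
  | .fvar x => (Tm.fvar x).rep v
  | .bvar d => .bvar d
  | .fn n i ts => Tm.repIf v (Tm.fn n i ts).WF (.fn n i fun j => Tm.tr v (ts j))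
  | .eps A => Tm.repIf v (Tm.eps A).WF (.eps (Fm.tr v A))

/-- Replace every closed subterm, from the inside outwards, by a representative. -/
noncomputable def Fm.tr (v : Fm → Prop) : Fm → Fm
  | .pred n i ts => .pred n i fun j => Tm.tr v (ts j)
  | .eq t u => .eq (Tm.tr v t) (Tm.tr v u)
  | .bot => .bot
  | .top => .top
  | .neg A => .neg (Fm.tr v A)
  | .and A B => .and (Fm.tr v A) (Fm.tr v B)
  | .or A B => .or (Fm.tr v A) (Fm.tr v B)
  | .imp A B => .imp (Fm.tr v A) (Fm.tr v B)
  | .iff A B => .iff (Fm.tr v A) (Fm.tr v B)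

end

theorem Tm.repIf_of_wf {v : Fm → Prop} {p : Prop} (hp : p) (s : Tm) :
    Tm.repIf v p s = s.rep v := by simp [Tm.repIf, hp]

theorem Tm.repIf_of_not {v : Fm → Prop} {p : Prop} (hp : ¬ p) (s : Tm) :
    Tm.repIf v p s = s := by simp [Tm.repIf, hp]

/-- `A` and `B` have the same dangling bound variables, with the same ranks above them. -/
def Tm.SameScope (t u : Tm) : Prop :=
  (∀ d, u.bcount d = t.bcount d) ∧ (∀ d, t.WFAt d → u.WFAt d) ∧ ∀ d, u.subRank d = t.subRank d

/-- `A` and `B` have the same dangling bound variables, with the same ranks above them. -/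
def Fm.SameScope (A B : Fm) : Prop :=
  (∀ d, B.bcount d = A.bcount d) ∧ (∀ d, A.WFAt d → B.WFAt d) ∧ ∀ d, B.subRank d = A.subRank d

theorem Tm.SameScope.of_wf {t u : Tm} (ht : t.WF) (hu : u.WF) : Tm.SameScope t u :=
  ⟨fun d => by rw [ht.bcount, hu.bcount], fun d _ => hu.wfAt d,
    fun d => by rw [ht.subRank, hu.subRank]⟩

namespace IsModel

variable {r : ℕ} {v : Fm → Prop}

theorem rep_spec (M : IsModel r v) {t : Tm} (ht : t.WF) : (t.rep v).WF ∧ v (.eq t (t.rep v)) :=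
  Classical.epsilon_spec (p := fun u : Tm => u.WF ∧ v (.eq t u)) ⟨t, ht, M.refl ht⟩

theorem rep_congr (M : IsModel r v) {t u : Tm} (ht : t.WF) (hu : u.WF) (h : v (.eq t u)) :
    t.rep v = u.rep v := by
  unfold Tm.rep
  congr 1
  funext w
  refine propext ⟨fun hw => ⟨hw.1, M.trans hu ht hw.1 (M.symm ht hu h) hw.2⟩,
    fun hw => ⟨hw.1, M.trans ht hu hw.1 h hw.2⟩⟩

theorem rep_rep (M : IsModel r v) {t : Tm} (ht : t.WF) : (t.rep v).rep v = t.rep v :=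
  (M.rep_congr ht (M.rep_spec ht).1 (M.rep_spec ht).2).symm

theorem sameScope_repIf (M : IsModel r v) {s s' : Tm} (h : Tm.SameScope s s') :
    Tm.SameScope s (Tm.repIf v s.WF s') := by
  by_cases hs : s.WF
  · rw [Tm.repIf_of_wf hs]
    exact .of_wf hs (M.rep_spec (h.2.1 0 hs)).1
  · rwa [Tm.repIf_of_not hs]

end IsModel

mutual

theorem Tm.sameScope_tr {r : ℕ} {v : Fm → Prop} (M : IsModel r v) :
    ∀ t : Tm, Tm.SameScope t (t.tr v)
  | .fvar x => by
      simp only [Tm.tr]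
      exact .of_wf (Tm.wf_fvar x) (M.rep_spec (Tm.wf_fvar x)).1
  | .bvar d => ⟨fun _ => rfl, fun _ h => h, fun _ => rfl⟩
  | .fn n i ts => by
      simp only [Tm.tr]
      have ih := fun j => Tm.sameScope_tr M (ts j)
      refine M.sameScope_repIf ⟨fun d => ?_, fun d h => ?_, fun d => ?_⟩
      · simp only [Tm.bcount, (ih _).1]
      · simp only [Tm.WFAt] at h ⊢
        exact fun j => (ih j).2.1 d (h j)
      · simp only [Tm.subRank, (ih _).2.2]
  | .eps A => by
      simp only [Tm.tr]
      have ih := Fm.sameScope_tr M A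
      refine M.sameScope_repIf ⟨fun d => ?_, fun d h => ?_, fun d => ?_⟩
      · simp only [Tm.bcount, ih.1]
      · simp only [Tm.WFAt, ih.1] at h ⊢
        exact ⟨ih.2.1 _ h.1, h.2⟩
      · simp only [Tm.subRank, ih.2.2, ih.1]

theorem Fm.sameScope_tr {r : ℕ} {v : Fm → Prop} (M : IsModel r v) :
    ∀ A : Fm, Fm.SameScope A (A.tr v)
  | .pred n i ts => by
      simp only [Fm.tr]
      have ih := fun j => Tm.sameScope_tr M (ts j)
      refine ⟨fun d => ?_, fun d h => ?_, fun d => ?_⟩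
      · simp only [Fm.bcount, (ih _).1]
      · simp only [Fm.WFAt] at h ⊢
        exact fun j => (ih j).2.1 d (h j)
      · simp only [Fm.subRank, (ih _).2.2]
  | .eq t u => by
      have ih := Tm.sameScope_tr M t
      have ih' := Tm.sameScope_tr M u
      simp only [Fm.tr]
      refine ⟨fun d => ?_, fun d h => ⟨ih.2.1 d h.1, ih'.2.1 d h.2⟩, fun d => ?_⟩
      · simp only [Fm.bcount, ih.1, ih'.1]
      · simp only [Fm.subRank, ih.2.2, ih'.2.2]
  | .bot | .top => ⟨fun _ => rfl, fun _ h => h, fun _ => rfl⟩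
  | .neg A => Fm.sameScope_tr M A
  | .and A B | .or A B | .imp A B | .iff A B => by
      have ih := Fm.sameScope_tr M A
      have ih' := Fm.sameScope_tr M B
      simp only [Fm.tr]
      refine ⟨fun d => ?_, fun d h => ⟨ih.2.1 d h.1, ih'.2.1 d h.2⟩, fun d => ?_⟩
      · simp only [Fm.bcount, ih.1, ih'.1]
      · simp only [Fm.subRank, ih.2.2, ih'.2.2]

end

mutual

theorem Tm.tr_subst_congr {v : Fm → Prop} {σ τ : ℕ → Tm} (hσ : ∀ y, (σ y).WF)
    (hτ : ∀ y, (τ y).WF) (h : ∀ y, (σ y).tr v = (τ y).tr v) :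
    ∀ t : Tm, (t.subst σ).tr v = (t.subst τ).tr v
  | .fvar x => h x
  | .bvar _ => rfl
  | .fn n i ts => by
      have hw : ((Tm.fn n i ts).subst σ).WF ↔ ((Tm.fn n i ts).subst τ).WF :=
        (Tm.wf_subst hσ _).trans (Tm.wf_subst hτ _).symm
      simp only [Tm.subst] at hw
      simp only [Tm.subst, Tm.tr, hw, Tm.tr_subst_congr hσ hτ h (ts _)]
  | .eps A => by
      have hw : ((Tm.eps A).subst σ).WF ↔ ((Tm.eps A).subst τ).WF :=
        (Tm.wf_subst hσ _).trans (Tm.wf_subst hτ _).symm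
      simp only [Tm.subst] at hw
      simp only [Tm.subst, Tm.tr, hw, Fm.tr_subst_congr hσ hτ h A]

theorem Fm.tr_subst_congr {v : Fm → Prop} {σ τ : ℕ → Tm} (hσ : ∀ y, (σ y).WF)
    (hτ : ∀ y, (τ y).WF) (h : ∀ y, (σ y).tr v = (τ y).tr v) :
    ∀ A : Fm, (A.subst σ).tr v = (A.subst τ).tr v
  | .pred n i ts => by simp only [Fm.subst, Fm.tr, Tm.tr_subst_congr hσ hτ h (ts _)]
  | .eq t u => by
      simp only [Fm.subst, Fm.tr, Tm.tr_subst_congr hσ hτ h t, Tm.tr_subst_congr hσ hτ h u]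
  | .bot | .top => rfl
  | .neg A => by simp only [Fm.subst, Fm.tr, Fm.tr_subst_congr hσ hτ h A]
  | .and A B | .or A B | .imp A B | .iff A B => by
      simp only [Fm.subst, Fm.tr, Fm.tr_subst_congr hσ hτ h A, Fm.tr_subst_congr hσ hτ h B]

end

namespace IsModel

variable {r : ℕ} {v : Fm → Prop}

theorem tr_wf (M : IsModel r v) {t : Tm} (ht : t.WF) : (t.tr v).WF := (t.sameScope_tr M).2.1 0 ht

theorem rep_tr (M : IsModel r v) {t : Tm} (ht : t.WF) : (t.tr v).rep v = t.tr v := by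
  cases t with
  | fvar x => exact M.rep_rep ht
  | bvar d => exact absurd ht (Tm.not_wf_bvar d)
  | fn n i ts =>
    simp only [Tm.tr]
    rw [Tm.repIf_of_wf ht]
    exact M.rep_rep (Tm.wf_fn.2 fun j => M.tr_wf (Tm.wf_fn.1 ht j))
  | eps A =>
    simp only [Tm.tr]
    rw [Tm.repIf_of_wf ht]
    have h := A.sameScope_tr M
    exact M.rep_rep (t := .eps (A.tr v)) ⟨h.2.1 1 ht.1, by rw [h.1]; exact ht.2⟩

theorem tr_eq_tr (M : IsModel r v) {t u : Tm} (ht : t.WF) (hu : u.WF)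
    (h : v (.eq (t.tr v) (u.tr v))) : t.tr v = u.tr v := by
  rw [← M.rep_tr ht, ← M.rep_tr hu]
  exact M.rep_congr (M.tr_wf ht) (M.tr_wf hu) h

/-- Similarity is preserved if the left term is replaced by a representative. -/
theorem sim_repIf (M : IsModel r v) {a b : Tm} (p : Prop) (h : TmSim r v a b)
    (hp : p → a.WF) : TmSim r v (Tm.repIf v p a) b := by
  by_cases hq : p
  · rw [Tm.repIf_of_wf hq]
    have ha := hp hq
    have hb : b.WF := (h.wfAt_iff 0).1 ha
    have hs := M.rep_spec ha
    exact .closed hs.1 hb (M.trans hs.1 ha hb (M.symm ha hs.1 hs.2) ((h.main M).2 ha))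
  · rwa [Tm.repIf_of_not hq]

end IsModel

mutual

theorem Tm.sim_tr_inst {r : ℕ} {v : Fm → Prop} (M : IsModel r v) {s t : Tm} (ht : t.WF)
    (hs : s.WF) (h : v (.eq (t.tr v) s)) :
    ∀ (a : Tm) (d : ℕ), 1 + a.subRank d ≤ r →
      TmSim r v ((Tm.inst t a d).tr v) (Tm.inst s (a.tr v) d)
  | .fvar x, d, _ => by
      rw [Tm.inst_of_bcount_eq_zero s]
      · exact TmSim.refl M _
      · exact (M.tr_wf (Tm.wf_fvar x)).bcount d
  | .bvar c, d, _ => by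
      simp only [Tm.inst, Tm.tr]
      split_ifs
      · exact .closed (M.tr_wf ht) hs h
      · exact .bvar c
  | .fn n i ts, d, hd => by
      by_cases hw : (Tm.fn n i ts).WF
      · rw [Tm.inst_of_bcount_eq_zero t (hw.bcount d),
          Tm.inst_of_bcount_eq_zero s ((M.tr_wf hw).bcount d)]
        exact TmSim.refl M _
      · simp only [Tm.inst, Tm.tr]
        rw [Tm.repIf_of_not hw]
        simp only [Tm.inst]
        refine M.sim_repIf _ (.fn n i fun j => Tm.sim_tr_inst M ht hs h (ts j) d ?_)
          fun hw' => Tm.wf_fn.2 fun j => M.tr_wf (Tm.wf_fn.1 hw' j)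
        have := Finset.le_sup (f := fun j => (ts j).subRank d) (Finset.mem_univ j)
        simp only [Tm.subRank] at hd
        omega
  | .eps A, d, hd => by
      by_cases hb : A.bcount (d + 1) = 0
      · rw [Tm.inst_of_bcount_eq_zero t (by simpa only [Tm.bcount] using hb),
          Tm.inst_of_bcount_eq_zero s
            (by rw [((Tm.eps A).sameScope_tr M).1]; simpa only [Tm.bcount] using hb)]
        exact TmSim.refl M _
      · have hw : ¬ (Tm.eps A).WF := fun hw => hb (hw.bcount d)
        simp only [Tm.inst, Tm.tr]
        rw [Tm.repIf_of_not hw]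
        simp only [Tm.inst]
        simp only [Tm.subRank, Nat.pos_of_ne_zero hb, if_true] at hd
        have hA := (Fm.inst t A (d + 1)).sameScope_tr M
        refine M.sim_repIf _ (.eps (Fm.sim_tr_inst M ht hs h A (d + 1) (by omega)) (.inl ?_))
          fun hw' => ⟨hA.2.1 1 hw'.1, by rw [hA.1]; exact hw'.2⟩
        rw [hA.2.2, Fm.subRank_inst ht A (by omega)]
        omega

theorem Fm.sim_tr_inst {r : ℕ} {v : Fm → Prop} (M : IsModel r v) {s t : Tm} (ht : t.WF)
    (hs : s.WF) (h : v (.eq (t.tr v) s)) :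
    ∀ (A : Fm) (d : ℕ), 1 + A.subRank d ≤ r →
      FmSim r v ((Fm.inst t A d).tr v) (Fm.inst s (A.tr v) d)
  | .pred n i ts, d, hd => by
      refine .pred n i fun j => Tm.sim_tr_inst M ht hs h (ts j) d ?_
      have := Finset.le_sup (f := fun j => (ts j).subRank d) (Finset.mem_univ j)
      simp only [Fm.subRank] at hd
      omega
  | .eq a b, d, hd => by
      simp only [Fm.subRank] at hd
      exact .eq (Tm.sim_tr_inst M ht hs h a d (by omega)) (Tm.sim_tr_inst M ht hs h b d (by omega))
  | .bot, _, _ => .bot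
  | .top, _, _ => .top
  | .neg A, d, hd => .neg (Fm.sim_tr_inst M ht hs h A d hd)
  | .and A B, d, hd => by
      simp only [Fm.subRank] at hd
      exact .and (Fm.sim_tr_inst M ht hs h A d (by omega)) (Fm.sim_tr_inst M ht hs h B d (by omega))
  | .or A B, d, hd => by
      simp only [Fm.subRank] at hd
      exact .or (Fm.sim_tr_inst M ht hs h A d (by omega)) (Fm.sim_tr_inst M ht hs h B d (by omega))
  | .imp A B, d, hd => by
      simp only [Fm.subRank] at hd
      exact .imp (Fm.sim_tr_inst M ht hs h A d (by omega)) (Fm.sim_tr_inst M ht hs h B d (by omega))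
  | .iff A B, d, hd => by
      simp only [Fm.subRank] at hd
      exact .iff (Fm.sim_tr_inst M ht hs h A d (by omega)) (Fm.sim_tr_inst M ht hs h B d (by omega))

end

mutual

theorem Tm.EpsFree.sim_tr {r : ℕ} {v : Fm → Prop} (M : IsModel r v) :
    ∀ {t : Tm}, t.EpsFree → TmSim r v (t.tr v) t
  | .fvar x, _ => by
      have hw := M.rep_spec (Tm.wf_fvar x)
      exact .closed hw.1 (Tm.wf_fvar x) (M.symm (Tm.wf_fvar x) hw.1 hw.2)
  | .bvar d, _ => .bvar d
  | .fn n i ts, h => by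
      simp only [Tm.EpsFree] at h
      simp only [Tm.tr]
      exact M.sim_repIf _ (.fn n i fun j => Tm.EpsFree.sim_tr M (h j))
        fun hw => Tm.wf_fn.2 fun j => M.tr_wf (Tm.wf_fn.1 hw j)
  | .eps A, h => by simp [Tm.EpsFree] at h

theorem Fm.EpsFree.sim_tr {r : ℕ} {v : Fm → Prop} (M : IsModel r v) :
    ∀ {A : Fm}, A.EpsFree → FmSim r v (A.tr v) A
  | .pred n i ts, h => by
      simp only [Fm.EpsFree] at h
      exact .pred n i fun j => Tm.EpsFree.sim_tr M (h j)
  | .eq t u, h => by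
      simp only [Fm.EpsFree] at h
      exact .eq (Tm.EpsFree.sim_tr M h.1) (Tm.EpsFree.sim_tr M h.2)
  | .bot, _ => .bot
  | .top, _ => .top
  | .neg A, h => .neg (Fm.EpsFree.sim_tr M (by simpa only [Fm.EpsFree] using h))
  | .and A B, h => by
      simp only [Fm.EpsFree] at h
      exact .and (Fm.EpsFree.sim_tr M h.1) (Fm.EpsFree.sim_tr M h.2)
  | .or A B, h => by
      simp only [Fm.EpsFree] at h
      exact .or (Fm.EpsFree.sim_tr M h.1) (Fm.EpsFree.sim_tr M h.2)
  | .imp A B, h => by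
      simp only [Fm.EpsFree] at h
      exact .imp (Fm.EpsFree.sim_tr M h.1) (Fm.EpsFree.sim_tr M h.2)
  | .iff A B, h => by
      simp only [Fm.EpsFree] at h
      exact .iff (Fm.EpsFree.sim_tr M h.1) (Fm.EpsFree.sim_tr M h.2)

end

theorem Fm.val_tr (v : Fm → Prop) :
    ∀ A : Fm, A.val (fun F => (F.tr v).val v) ↔ (A.tr v).val v
  | .pred _ _ _ | .eq _ _ | .bot | .top => Iff.rfl
  | .neg A => not_congr (Fm.val_tr v A)
  | .and A B => and_congr (Fm.val_tr v A) (Fm.val_tr v B)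
  | .or A B => or_congr (Fm.val_tr v A) (Fm.val_tr v B)
  | .imp A B => imp_congr (Fm.val_tr v A) (Fm.val_tr v B)
  | .iff A B => iff_congr (Fm.val_tr v A) (Fm.val_tr v B)

namespace IsModel

variable {r : ℕ} {v : Fm → Prop}

theorem val_tr_crit (M : IsModel r v) {F : Fm} {e : Tm} (hF : IsCrit F e) (hr : e.rank ≤ r)
    (hw : F.WF) : (F.tr v).val v := by
  obtain ⟨A, t, rfl, he, ht, rfl⟩ := hF
  simp only [Tm.rank] at hr
  have hs := A.sameScope_tr M
  have he' : (Tm.eps (A.tr v)).WF := ⟨hs.2.1 1 he.1, by rw [hs.1]; exact he.2⟩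
  have h1 := A.sim_tr_inst M ht (M.tr_wf ht) (M.refl (M.tr_wf ht)) 0 hr
  have h2 := A.sim_tr_inst M (t := .eps A) (s := .eps (A.tr v)) he he' (by
    have := M.rep_spec he'
    simp only [Tm.tr]
    rw [Tm.repIf_of_wf he]
    exact M.symm he' this.1 this.2) 0 hr
  have w1 : ((A.app t).tr v).WF := (Fm.sameScope_tr M _).2.1 0 hw.1
  have w2 : ((A.app (.eps A)).tr v).WF := (Fm.sameScope_tr M _).2.1 0 hw.2
  intro h
  refine ((h2.main M).2 w2).2 ?_
  have h := ((h1.main M).2 w1).1 h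
  by_cases hne : (A.tr v).app (t.tr v) = (A.tr v).app (.eps (A.tr v))
  · exact (congrArg (Fm.val v) hne).mp h
  · have hc : IsCrit (.imp ((A.tr v).app (t.tr v)) ((A.tr v).app (.eps (A.tr v))))
        (.eps (A.tr v)) := ⟨A.tr v, t.tr v, rfl, he', M.tr_wf ht, rfl⟩
    refine M.val_of_restricted (.crit _ _ hc fun f hf => (hc.rank_le hf hne).trans ?_)
      ⟨(h1.wfAt_iff 0).1 w1, (h2.wfAt_iff 0).1 w2⟩ h
    simp only [Tm.rank, hs.2.2]
    exact hr

/-- All axioms, with critical formulas of rank `≤ r`, hold when `ε`-terms are evaluated at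
representatives. -/
theorem val_tr_of_isAxiom (M : IsModel r v) {F : Fm} (hF : IsAxiom F) (hw : F.WF)
    (hr : ∀ e, IsCrit F e → e.rank ≤ r) : (F.tr v).val v := by
  cases hF with
  | taut _ h => exact (Fm.val_tr v F).1 (h _)
  | refl t => exact M.refl (M.tr_wf hw.1)
  | predId n i s j t u =>
    intro h h'
    simp only [Fm.tr, Fm.val] at h h' ⊢
    have e := M.tr_eq_tr hw.1.1 hw.1.2 h
    convert h' using 3 with k
    by_cases hk : k = j
    · subst hk; simp [e]
    · simp [hk]
  | eqIdLeft t u s =>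
    intro h h'
    simp only [Fm.tr, Fm.val] at h h' ⊢
    rwa [← M.tr_eq_tr hw.1.1 hw.1.2 h]
  | eqIdRight t u s =>
    intro h h'
    simp only [Fm.tr, Fm.val] at h h' ⊢
    rwa [← M.tr_eq_tr hw.1.1 hw.1.2 h]
  | fnId n i s j t u =>
    intro h
    have e := M.tr_eq_tr hw.1.1 hw.1.2 h
    have e' : (Tm.fn n i (Function.update s j t)).tr v =
        (Tm.fn n i (Function.update s j u)).tr v := by
      simp only [Tm.tr]
      rw [Tm.repIf_of_wf (show Tm.WF _ from hw.2.1), Tm.repIf_of_wf (show Tm.WF _ from hw.2.2)]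
      congr 2
      funext k
      by_cases hk : k = j
      · subst hk; simp [e]
      · simp [hk]
    change v (.eq (Tm.tr v _) (Tm.tr v _))
    rw [e']
    exact M.refl (M.tr_wf hw.2.2)
  | epsId _ e' e h =>
    obtain ⟨p, σ, x, t, u, -, -, hσ, ht, hu, rfl, rfl, rfl⟩ := h
    intro h
    have e := M.tr_eq_tr ht hu h
    have hup : ∀ s : Tm, s.WF → ∀ y, (Function.update σ x s y).WF := fun s hs y => by
      by_cases hy : y = x
      · subst hy; simpa using hs
      · simpa [hy] using hσ y
    change v (.eq (Tm.tr v _) (Tm.tr v _))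
    rw [Tm.tr_subst_congr (hup t ht) (hup u hu) fun y => ?_]
    · exact M.refl (M.tr_wf hw.2.2)
    · by_cases hy : y = x
      · subst hy; simpa using e
      · simp [hy]
  | crit _ e h => exact M.val_tr_crit h (hr e h) hw

theorem val_of_isProof (M : IsModel r v) {π : List Fm} {E : Fm} (hE : E.EpsFree)
    (hπ : IsProof π E) (hr : ∀ e, CriticalIn e π → e.rank ≤ r) : E.val v := by
  obtain ⟨hlast, hwf, hstep⟩ := hπ
  have key : ∀ i (hi : i < π.length), ((π[i]).tr v).val v := by
    intro i
    induction i using Nat.strong_induction_on with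
    | _ i ih =>
      intro hi
      rcases hstep i hi with h | ⟨k, l, hk, hl, h⟩
      · exact M.val_tr_of_isAxiom h (hwf _ (List.getElem_mem hi))
          fun e he => hr e ⟨_, List.getElem_mem hi, he⟩
      · have h1 := ih k hk (hk.trans hi)
        have h2 := ih l hl (hl.trans hi)
        rw [h] at h2
        exact h2 h1
  have hmem := List.mem_of_getLast? hlast
  obtain ⟨i, hi, rfl⟩ := List.getElem_of_mem hmem
  exact (((hE.sim_tr M).main M).2 ((Fm.sameScope_tr M _).2.1 0 (hwf _ hmem))).1 (key i hi)

end IsModel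

/-! ### Compactness of propositional consequence -/

theorem Fm.val_ultrafilter {ι : Type*} (U : Ultrafilter ι) (v : ι → Fm → Prop) :
    ∀ A : Fm, A.val (fun F => ∀ᶠ s in (U : Filter ι), v s F) ↔
      ∀ᶠ s in (U : Filter ι), A.val (v s)
  | .pred _ _ _ | .eq _ _ => Iff.rfl
  | .bot => by simp [Fm.val, U.neBot.ne]
  | .top => by simp [Fm.val]
  | .neg A => by
      simp only [Fm.val, Ultrafilter.eventually_not, Fm.val_ultrafilter U v A]
  | .and A B => by
      simp only [Fm.val, Filter.eventually_and, Fm.val_ultrafilter U v A, Fm.val_ultrafilter U v B]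
  | .or A B => by
      simp only [Fm.val, Ultrafilter.eventually_or, Fm.val_ultrafilter U v A,
        Fm.val_ultrafilter U v B]
  | .imp A B => by
      simp only [Fm.val, Ultrafilter.eventually_imp, Fm.val_ultrafilter U v A,
        Fm.val_ultrafilter U v B]
  | .iff A B => by
      simp only [Fm.val, iff_iff_implies_and_implies, Filter.eventually_and,
        Ultrafilter.eventually_imp, Fm.val_ultrafilter U v A, Fm.val_ultrafilter U v B]

theorem exists_finite_consequence (Γ : Fm → Prop) (E : Fm)
    (h : ∀ v : Fm → Prop, (∀ F, Γ F → F.val v) → E.val v) :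
    ∃ Δ : List Fm, (∀ F ∈ Δ, Γ F) ∧ ∀ v : Fm → Prop, (∀ F ∈ Δ, F.val v) → E.val v := by
  classical
  by_contra! hcon
  have hex : ∀ s : Finset {F // Γ F}, ∃ v : Fm → Prop, (∀ F ∈ s, F.1.val v) ∧ ¬ E.val v := by
    intro s
    obtain ⟨v, hv, hE⟩ := hcon (s.toList.map Subtype.val) (by
      intro F hF
      obtain ⟨G, -, rfl⟩ := List.mem_map.1 hF
      exact G.2)
    exact ⟨v, fun F hF => hv _ (List.mem_map_of_mem (Finset.mem_toList.2 hF)), hE⟩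
  choose v hv hE using hex
  let U : Ultrafilter (Finset {F // Γ F}) := Ultrafilter.of Filter.atTop
  have hU := h (fun F => ∀ᶠ s in (U : Filter _), v s F) fun F hF => by
    rw [Fm.val_ultrafilter]
    refine (Ultrafilter.of_le _) ?_
    filter_upwards [Filter.eventually_ge_atTop ({⟨F, hF⟩} : Finset {F // Γ F})] with s hs
    exact hv s _ (hs (Finset.mem_singleton_self _))
  rw [Fm.val_ultrafilter] at hU
  obtain ⟨s, hs⟩ := hU.exists
  exact hE s hs

/-! ### Building proofs -/

/-- Every formula of `π` is an axiom or follows from two earlier ones by modus ponens. -/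
def IsDerivation (π : List Fm) : Prop :=
  (∀ F ∈ π, F.WF) ∧ ∀ i (hi : i < π.length), IsAxiom π[i] ∨
    ∃ k l, ∃ (hk : k < i) (hl : l < i), π[l] = .imp π[k] π[i]

theorem isDerivation_of_axioms {π : List Fm} (hw : ∀ F ∈ π, F.WF) (h : ∀ F ∈ π, IsAxiom F) :
    IsDerivation π :=
  ⟨hw, fun _ hi => .inl (h _ (List.getElem_mem hi))⟩

theorem IsDerivation.mp {π : List Fm} {F G : Fm} (h : IsDerivation π) (hF : F ∈ π)
    (hFG : .imp F G ∈ π) : IsDerivation (π ++ [G]) := by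
  refine ⟨fun A hA => ?_, fun i hi => ?_⟩
  · rcases List.mem_append.1 hA with hA | hA
    · exact h.1 A hA
    · rw [List.mem_singleton.1 hA]
      exact (h.1 _ hFG).2
  · rcases Nat.lt_or_ge i π.length with hi' | hi'
    · rw [List.getElem_append_left hi']
      rcases h.2 i hi' with h1 | ⟨k, l, hk, hl, h1⟩
      · exact .inl h1
      · refine .inr ⟨k, l, hk, hl, ?_⟩
        rwa [List.getElem_append_left (hl.trans hi'), List.getElem_append_left (hk.trans hi')]
    · have hi2 : i = π.length := by
        simp only [List.length_append, List.length_singleton] at hi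
        omega
      subst hi2
      obtain ⟨k, hk, hk'⟩ := List.getElem_of_mem hF
      obtain ⟨l, hl, hl'⟩ := List.getElem_of_mem hFG
      refine .inr ⟨k, l, hk, hl, ?_⟩
      rw [List.getElem_append_left hl, List.getElem_append_left hk, hk', hl']
      simp

/-- `A_1 → (A_2 → ⋯ → E)`. -/
def imps (Δ : List Fm) (E : Fm) : Fm := Δ.foldr Fm.imp E

theorem val_imps (v : Fm → Prop) (E : Fm) :
    ∀ Δ : List Fm, (imps Δ E).val v ↔ ((∀ F ∈ Δ, F.val v) → E.val v)
  | [] => by simp [imps]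
  | A :: Δ => by
      have ih := val_imps v E Δ
      simp only [imps, List.foldr_cons, Fm.val, List.forall_mem_cons, and_imp] at ih ⊢
      rw [ih]

theorem wf_imps {E : Fm} (hE : E.WF) : ∀ {Δ : List Fm}, (∀ F ∈ Δ, F.WF) → (imps Δ E).WF
  | [], _ => hE
  | _ :: _, h => ⟨h _ (by simp), wf_imps hE fun _ hF => h _ (List.mem_cons_of_mem _ hF)⟩

/-- `F` is neither a critical formula nor an `ε`-identity formula. -/
def Inert (F : Fm) : Prop := (∀ e, ¬ IsCrit F e) ∧ ∀ e' e, ¬ IsEpsId F e' e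

theorem IsDerivation.discharge {E : Fm} :
    ∀ {Δ π : List Fm}, IsDerivation π → (∀ F ∈ Δ, F ∈ π) → imps Δ E ∈ π →
      (∀ Δ', Δ' <:+ Δ → Inert (imps Δ' E)) →
      ∃ π', IsDerivation π' ∧ E ∈ π' ∧ (∀ F ∈ π, F ∈ π') ∧ ∀ F ∈ π', F ∈ π ∨ Inert F
  | [], π, h, _, hE, _ => ⟨π, h, hE, fun _ hF => hF, fun _ hF => .inl hF⟩
  | A :: Δ, π, h, hΔ, hE, hin => by
      obtain ⟨π', h1, h2, h3, h4⟩ := IsDerivation.discharge (Δ := Δ) (E := E)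
        (h.mp (hΔ A (by simp)) hE)
        (fun F hF => List.mem_append_left _ (hΔ F (List.mem_cons_of_mem _ hF)))
        (List.mem_append_right _ (List.mem_singleton_self _))
        fun Δ' hs => hin Δ' (hs.trans (List.suffix_cons _ _))
      refine ⟨π', h1, h2, fun F hF => h3 F (List.mem_append_left _ hF), fun F hF => ?_⟩
      rcases h4 F hF with h5 | h5
      · rcases List.mem_append.1 h5 with h5 | h5
        · exact .inl h5
        · rw [List.mem_singleton.1 h5]
          exact .inr (hin Δ (List.suffix_cons _ _))
      · exact .inr h5

/-- Number of connectives. -/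
def Fm.conn : Fm → ℕ
  | .pred _ _ _ | .eq _ _ | .bot | .top => 0
  | .neg A => 1 + A.conn
  | .and A B | .or A B | .imp A B | .iff A B => 1 + A.conn + B.conn

theorem Fm.conn_inst (s : Tm) : ∀ (A : Fm) (d : ℕ), (Fm.inst s A d).conn = A.conn
  | .pred _ _ _, _ | .eq _ _, _ | .bot, _ | .top, _ => rfl
  | .neg A, d => by simp only [Fm.inst, Fm.conn, Fm.conn_inst s A d]
  | .and A B, d | .or A B, d | .imp A B, d | .iff A B, d => by
      simp only [Fm.inst, Fm.conn, Fm.conn_inst s A d, Fm.conn_inst s B d]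

theorem IsCrit.conn_eq {A B : Fm} {e : Tm} (h : IsCrit (.imp A B) e) : A.conn = B.conn := by
  obtain ⟨C, t, -, -, -, h⟩ := h
  simp only [Fm.imp.injEq] at h
  rw [h.1, h.2, Fm.app, Fm.app, Fm.conn_inst, Fm.conn_inst]

theorem IsCrit.not_epsFree {A B : Fm} {e : Tm} (h : IsCrit (.imp A B) e) : ¬ B.EpsFree := by
  obtain ⟨C, t, rfl, he, -, h⟩ := h
  simp only [Fm.imp.injEq] at h
  intro hB
  refine hB.not_occ (A := C) ?_
  rw [h.2]
  exact Fm.occ_inst _ he.2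

theorem IsEpsId.not_epsFree {A B : Fm} {e' e : Tm} (h : IsEpsId (.imp A B) e' e) :
    ¬ B.EpsFree := by
  obtain ⟨p, σ, x, t, u, ⟨-, ⟨P, rfl⟩, -, -⟩, -, -, -, -, rfl, rfl, h⟩ := h
  simp only [Fm.imp.injEq] at h
  rw [h.2]
  simp [Fm.EpsFree, Tm.EpsFree, Tm.subst]

theorem Fm.EpsFree.inert {E : Fm} (hE : E.EpsFree) : Inert E := by
  refine ⟨fun e he => ?_, fun e' e he => ?_⟩
  · obtain ⟨C, t, -, -, -, rfl⟩ := id he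
    exact he.not_epsFree hE.2
  · obtain ⟨p, σ, x, t, u, -, -, -, -, -, -, -, rfl⟩ := id he
    exact he.not_epsFree hE.2

/-- A tautology with `2 * n` connectives. -/
def padding : ℕ → Fm
  | 0 => .top
  | n + 1 => .neg (.neg (padding n))

theorem val_padding (v : Fm → Prop) : ∀ n, (padding n).val v
  | 0 => trivial
  | n + 1 => not_not.2 (val_padding v n)

theorem wf_padding : ∀ n, (padding n).WF
  | 0 => trivial
  | n + 1 => wf_padding n

theorem le_conn_padding : ∀ n, n ≤ (padding n).conn
  | 0 => Nat.zero_le _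
  | n + 1 => by
      have := le_conn_padding n
      simp only [padding, Fm.conn]
      omega

theorem inert_padding (n : ℕ) : Inert (padding n) := by
  cases n <;>
  · refine ⟨fun e he => ?_, fun e' e he => ?_⟩
    · obtain ⟨C, t, -, -, -, h⟩ := he
      cases h
    · obtain ⟨p, σ, x, t, u, -, -, -, -, -, -, -, h⟩ := he
      cases h

theorem conn_le_imps (E : Fm) : ∀ Δ : List Fm, E.conn ≤ (imps Δ E).conn
  | [] => le_rfl
  | A :: Δ => by
      have := conn_le_imps E Δ
      simp only [imps, List.foldr_cons, Fm.conn] at this ⊢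
      omega

theorem inert_imps {E : Fm} (hE : E.EpsFree) (n : ℕ) :
    ∀ Δ : List Fm, (∀ F ∈ Δ, F.conn ≤ n) → Inert (imps Δ (.imp (padding n) E))
  | [], _ => ⟨fun _ h => h.not_epsFree hE, fun _ _ h => h.not_epsFree hE⟩
  | A :: Δ, h => by
      refine ⟨fun e he => ?_, fun e' e he => ?_⟩
      · have h1 := IsCrit.conn_eq (A := A) (B := imps Δ (.imp (padding n) E)) he
        have h2 := conn_le_imps (.imp (padding n) E) Δ
        have h3 := le_conn_padding n
        have h4 := h A (by simp)
        simp only [Fm.conn] at h2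
        omega
      · obtain ⟨p, σ, x, t, u, -, -, -, -, -, -, -, h'⟩ := he
        cases Δ <;> simp [imps] at h'

theorem exists_isProof_of_taut {E : Fm} (hE : E.EpsFree) (hw : E.WF) {Δ : List Fm}
    (hΔw : ∀ F ∈ Δ, F.WF) (hΔ : ∀ F ∈ Δ, IsAxiom F)
    (h : ∀ v : Fm → Prop, (∀ F ∈ Δ, F.val v) → E.val v) :
    ∃ π, IsProof π E ∧ (∀ F ∈ Δ, F ∈ π) ∧ ∀ F ∈ π, F ∈ Δ ∨ Inert F := by
  obtain ⟨n, hn⟩ : ∃ n, ∀ F ∈ Δ, F.conn ≤ n :=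
    ⟨(Δ.map Fm.conn).sum, fun F hF =>
      List.single_le_sum (fun _ _ => Nat.zero_le _) _ (List.mem_map_of_mem hF)⟩
  have hsuf : ∀ Δ', Δ' <:+ Δ → Inert (imps Δ' (.imp (padding n) E)) := fun Δ' hs =>
    inert_imps hE n Δ' fun F hF => hn F (hs.subset hF)
  set X : Fm := .imp (padding n) E with hX
  have hXw : X.WF := ⟨wf_padding n, hw⟩
  have h0 : IsDerivation (Δ ++ [padding n, imps Δ X]) := by
    refine isDerivation_of_axioms (fun F hF => ?_) fun F hF => ?_
    · simp only [List.mem_append, List.mem_cons, List.not_mem_nil, or_false] at hF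
      rcases hF with hF | rfl | rfl
      exacts [hΔw F hF, wf_padding n, wf_imps hXw hΔw]
    · simp only [List.mem_append, List.mem_cons, List.not_mem_nil, or_false] at hF
      rcases hF with hF | rfl | rfl
      · exact hΔ F hF
      · exact .taut _ fun v => val_padding v n
      · exact .taut _ fun v => (val_imps v X Δ).2 fun hv _ => h v hv
  obtain ⟨π, h1, h2, h3, h4⟩ := h0.discharge (Δ := Δ) (E := X) (by simp +contextual) (by simp) hsuf
  have h5 := h1.mp (h3 (padding n) (by simp)) h2
  refine ⟨π ++ [E], ⟨by simp, h5.1, h5.2⟩,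
    fun F hF => List.mem_append_left _ (h3 F (by simp [hF])), fun F hF => ?_⟩
  rcases List.mem_append.1 hF with hF | hF
  · rcases h4 F hF with hF | hF
    · simp only [List.mem_append, List.mem_cons, List.not_mem_nil, or_false] at hF
      rcases hF with hF | rfl | rfl
      exacts [.inl hF, .inr (inert_padding n), .inr (hsuf Δ (List.suffix_refl _))]
    · exact .inr hF
  · rw [List.mem_singleton.1 hF]
    exact .inr hE.inert

/-! ### Elimination of `ε`-identity formulas of maximal rank -/

theorem RestrictedAxiom.isAxiom {r : ℕ} {F : Fm} (h : RestrictedAxiom r F) : IsAxiom F := by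
  cases h with
  | refl t => exact .refl t
  | predId n i s j t u => exact .predId n i s j t u
  | eqIdLeft t u s => exact .eqIdLeft t u s
  | eqIdRight t u s => exact .eqIdRight t u s
  | fnId n i s j t u => exact .fnId n i s j t u
  | epsId _ e' e h _ => exact .epsId _ e' e h
  | crit _ e h _ => exact .crit _ e h

theorem RestrictedAxiom.rank_le {r : ℕ} {F : Fm} {c : Tm} (h : RestrictedAxiom r F)
    (hc : IsCrit F c) : c.rank ≤ r := by
  cases h with
  | refl t => obtain ⟨C, t, -, -, -, h⟩ := hc; cases h
  | predId n i s j t u => simpa [Fm.conn] using hc.conn_eq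
  | eqIdLeft t u s => simpa [Fm.conn] using hc.conn_eq
  | eqIdRight t u s => simpa [Fm.conn] using hc.conn_eq
  | fnId n i s j t u => exact absurd hc not_isCrit_fnId
  | epsId _ e' e h _ => exact absurd hc (h.not_isCrit c)
  | crit _ e h h' => exact h' c hc

theorem RestrictedAxiom.rank_lt {r : ℕ} {F : Fm} {c' c : Tm} (h : RestrictedAxiom r F)
    (hc : IsEpsId F c' c) : c.rank < r := by
  have hF := hc
  obtain ⟨p, σ, x, t, u, ⟨-, ⟨P, rfl⟩, -, -⟩, -, -, -, -, hc', rfl, h'⟩ := hc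
  cases h with
  | refl t => cases h'
  | predId n i s j t u => cases h'
  | eqIdLeft t u s => cases h'
  | eqIdRight t u s => cases h'
  | fnId n i s j t u => simp [Tm.subst] at h'
  | epsId _ e' e h hr =>
    obtain ⟨q, τ, y, t', u', -, -, -, -, -, -, -, hs⟩ := h
    rw [hs] at h'
    simp only [Fm.imp.injEq, Fm.eq.injEq] at h'
    rwa [← h'.2.2]
  | crit _ e h _ => exact absurd h (hF.not_isCrit e)

end EpsCalc

theorem mainTheorem2 (π : List EpsCalc.Fm) (E : EpsCalc.Fm)
    (hE : E.EpsFree) (hπ : EpsCalc.IsProof π E) :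
    ∃ π' : List EpsCalc.Fm, EpsCalc.IsProof π' E ∧
      EpsCalc.proofRank π' = EpsCalc.proofRank π ∧
      ∀ e, EpsCalc.SpecialIn e π' → e.rank < EpsCalc.proofRank π := by
  open EpsCalc in
  have hle : ∀ e, CriticalIn e π → e.rank ≤ proofRank π := fun e he =>
    le_csSup (bddAbove_critical_ranks π) ⟨e, he, rfl⟩
  obtain ⟨Δ, hΔ, hcons⟩ := exists_finite_consequence
    (fun F => F.WF ∧ RestrictedAxiom (proofRank π) F) E
    fun v hv => IsModel.val_of_isProof (r := proofRank π) (fun F hw hF => hv F ⟨hw, hF⟩) hE hπ hle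
  obtain ⟨Θ, hΘ, hcrit⟩ : ∃ Θ : List Fm, (∀ F ∈ Θ, F.WF ∧ RestrictedAxiom (proofRank π) F) ∧
      (proofRank π = 0 ∨ ∃ F ∈ Θ, ∃ e, IsCrit F e ∧ e.rank = proofRank π) := by
    rcases Set.eq_empty_or_nonempty {r | ∃ e, CriticalIn e π ∧ e.rank = r} with h | h
    · exact ⟨[], by simp, .inl (by rw [proofRank, h]; exact csSup_empty)⟩
    · obtain ⟨e, ⟨F, hF, he⟩, hr⟩ := Nat.sSup_mem h (bddAbove_critical_ranks π)
      refine ⟨[F], fun G hG => ?_, .inr ⟨F, by simp, e, he, hr⟩⟩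
      rw [List.mem_singleton.1 hG]
      exact ⟨hπ.2.1 F hF, .crit F e he fun e' he' => hle e' ⟨F, hF, he'⟩⟩
  have hall : ∀ F ∈ Δ ++ Θ, F.WF ∧ RestrictedAxiom (proofRank π) F := fun F hF =>
    (List.mem_append.1 hF).elim (hΔ F) (hΘ F)
  obtain ⟨π', hπ', hsub, hinert⟩ := exists_isProof_of_taut hE
    (hπ.2.1 E (List.mem_of_getLast? hπ.1)) (fun F hF => (hall F hF).1)
    (fun F hF => (hall F hF).2.isAxiom)
    fun v hv => hcons v fun F hF => hv F (List.mem_append_left _ hF)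
  have hle' : ∀ e, CriticalIn e π' → e.rank ≤ proofRank π := by
    rintro e ⟨F, hF, he⟩
    rcases hinert F hF with h | h
    · exact (hall F h).2.rank_le he
    · exact absurd he (h.1 e)
  refine ⟨π', hπ', le_antisymm (csSup_le' ?_) ?_, ?_⟩
  · rintro r ⟨e, he, rfl⟩
    exact hle' e he
  · rcases hcrit with h | ⟨F, hF, e, he, hr⟩
    · rw [h]
      exact Nat.zero_le _
    · exact le_csSup (bddAbove_critical_ranks π')
        ⟨e, ⟨F, hsub F (List.mem_append_right _ hF), he⟩, hr⟩
  · rintro e ⟨F, hF, e', he⟩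
    rcases hinert F hF with h | h
    · exact (hall F h).2.rank_lt he
    · exact absurd he (h.2 e' e)
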